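/- Let $\mathcal X$ be a measurable space and $\mathcal Y=\{0,1\}$. For a probability distribution $P$ on $\mathcal X\times\mathcal Y$ with marginal $P_X$ on $\mathcal X$, a classifier $f:\mathcal X\to\mathcal Y$ and a class $\mathcal H$ of (measurable) classifiers, write $R_P(f)=P(f(X)\neq Y)$ and $R_{P,\mathcal H}=\inf_{h\in\mathcal H}R_P(h)$. For a set $\mathcal P$ of probability distributions on $\mathcal X\times\mathcal Y$ and $\ell\ge 1$ define the minimax expected excess risks $$L(\ell)=\inf_{A}\ \sup_{P\in\mathcal P}\ \mathbb E_{S\sim P^\ell}\bigl(R_P(A(S))-R_{P,\mathcal H}\bigr)_+,\qquad L^{\mathrm{mar}}(\ell)=\inf_{A}\ \sup_{P\in\mathcal P}\ \mathbb E_{S\sim P^\ell}\bigl(R_P(A(S,P_X))-R_{P,\mathcal H}\bigr)_+,$$ where the first infimum is over all maps $A$ from samples in $(\mathcal X\times\mathcal Y)^\ell$ to classifiers, and the second over all maps that receive the marginal $P_X$ as an additional input (expectations of non-measurable quantities are upper expectations). *Knowing the marginal helps* to learn $\mathcal H$ over $\mathcal P$ if $\lim_{\ell\to\infty}L^{\mathrm{mar}}(\ell)/L(\ell)=0$.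 Call $\mathcal P$ *rich* for $\mathcal H$ if there are $h,h'\in\mathcal H$ and a probability distribution $\mu$ on $\mathcal X$ with $$\mu(\{x: h(x)\ne h'(x),\ h(x)=0\})\neq\mu(\{x: h(x)\ne h'(x),\ h(x)=1\})$$ such that for every $\alpha\in(0,\tfrac12)$ the set $\mathcal P$ contains the distributions $P_\alpha$ and $P_{-\alpha}$ with marginal $\mu$ and labeling functions $P_{\pm\alpha}(Y=1\mid X=x)=\tfrac12\pm\alpha$ where $h(x)\neq h'(x)$, and $=h(x)$ where $h(x)=h'(x)$. **Theorem.** Let $\mathcal H$ have finite VC dimension and let $\mathcal P$ be rich for $\mathcal H$. Assume the usual measurability of the class: for all $P\in\mathcal P$, $n\in\mathbb N$ and $b\in\{0,1\}^n$, the set of $(x_1,\dots,x_n)\in\mathcal X^n$ such that $(h(x_1),\dots,h(x_n))=b$ for some $h\in\mathcal H$ is measurable for the completion of $P_X^n$ (this holds e.g. if $\mathcal H$ is countable). Then knowing the marginal does not help to learn $\mathcal H$ over $\mathcal P$. More precisely, both $L(\ell)$ and $L^{\mathrm{mar}}(\ell)$ are of order $1/\sqrt\ell$: there are constants $c_1,c_2>0$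 (depending on $\mathcal H$ and $\mathcal P$) such that $c_1/\sqrt\ell\le L^{\mathrm{mar}}(\ell)\le L(\ell)\le c_2/\sqrt\ell$ for all $\ell\ge1$. -/

import Mathlib

open MeasureTheory
open scoped ENNReal

namespace SSL

noncomputable section

/-- The finite set `s` is shattered by the class `H` of classifiers `X → Bool`
(labels: `false` is `0`, `true` is `1`). -/
def Shatters {X : Type*} (H : Set (X → Bool)) (s : Finset X) : Prop :=
  ∀ t : Finset X, t ⊆ s → ∃ h ∈ H, ∀ x ∈ s, (h x = true ↔ x ∈ t)

/-- The VC dimension of `H` is finite: the cardinalities of shattered sets are bounded. -/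
def FiniteVCDim {X : Type*} (H : Set (X → Bool)) : Prop :=
  ∃ d : ℕ, ∀ s : Finset X, Shatters H s → s.card ≤ d

variable {X : Type*} [MeasurableSpace X]

/-- The usual measurability requirement on a possibly uncountable class `H` under the marginal `μ`:
for every `n` and every label pattern `b`, the set of points `(x₁, …, xₙ)` on which some member of
`H` realizes `b` is measurable with respect to the completion of `μⁿ`. (Equivalently, the suprema
over `h ∈ H` of the sums `∑ eᵢ h(xᵢ)` are measurable with respect to that completion.) It holds for
every countable class of measurable classifiers. -/
def IsMeasurableClass (H : Set (X → Bool)) (μ : Measure X) : Prop :=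
  ∀ (n : ℕ) (b : Fin n → Bool),
    NullMeasurableSet {x : Fin n → X | ∃ h ∈ H, ∀ i, h (x i) = b i} (Measure.pi fun _ => μ)

/-- The risk `P(f(X) ≠ Y)`. -/
def risk (P : ProbabilityMeasure (X × Bool)) (f : X → Bool) : ℝ≥0∞ :=
  (P : Measure (X × Bool)) {p | f p.1 ≠ p.2}

/-- The minimal risk over the class `H`. -/
def bestRisk (P : ProbabilityMeasure (X × Bool)) (H : Set (X → Bool)) : ℝ≥0∞ :=
  ⨅ h ∈ H, risk P h

/-- The positive part of the excess risk (subtraction in `ℝ≥0∞` is truncated at zero). -/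
def excessRisk (P : ProbabilityMeasure (X × Bool)) (H : Set (X → Bool)) (f : X → Bool) : ℝ≥0∞ :=
  risk P f - bestRisk P H

/-- The marginal on the feature space. -/
def marginal (P : ProbabilityMeasure (X × Bool)) : Measure X :=
  (P : Measure (X × Bool)).fst

/-- The law of an i.i.d. labeled sample of size `ℓ`. -/
def sampleLaw (P : ProbabilityMeasure (X × Bool)) (ℓ : ℕ) : Measure (Fin ℓ → X × Bool) :=
  Measure.pi fun _ => (P : Measure (X × Bool))

/-- The (upper) expectation of a nonnegative quantity. It is `∫⁻ f ∂μ` for measurable `f`; since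
learning algorithms are arbitrary maps, their risk need not depend measurably on the sample. -/
def expectation {Ω : Type*} [MeasurableSpace Ω] (μ : Measure Ω) (f : Ω → ℝ≥0∞) : ℝ≥0∞ :=
  ⨅ (g : Ω → ℝ≥0∞) (_ : Measurable g) (_ : ∀ ω, f ω ≤ g ω), ∫⁻ ω, g ω ∂μ

/-- A supervised algorithm: for each `ℓ`, a map from labeled samples of size `ℓ` to classifiers. -/
abbrev SLAlgorithm (X : Type*) : Type _ :=
  ∀ ℓ : ℕ, (Fin ℓ → X × Bool) → (X → Bool)

/-- An algorithm that receives the marginal distribution in addition to the labeled sample. -/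
abbrev MarginalAlgorithm (X : Type*) [MeasurableSpace X] : Type _ :=
  ∀ ℓ : ℕ, (Fin ℓ → X × Bool) → Measure X → (X → Bool)

/-- The minimax expected excess risk of supervised learning. -/
def minimaxSL (H : Set (X → Bool)) (𝓟 : Set (ProbabilityMeasure (X × Bool))) (ℓ : ℕ) : ℝ≥0∞ :=
  ⨅ A : SLAlgorithm X, ⨆ P ∈ 𝓟, expectation (sampleLaw P ℓ) fun S => excessRisk P H (A ℓ S)

/-- The minimax expected excess risk of learners that are given the marginal. -/
def minimaxMarginal (H : Set (X → Bool)) (𝓟 : Set (ProbabilityMeasure (X × Bool))) (ℓ : ℕ) :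
    ℝ≥0∞ :=
  ⨅ A : MarginalAlgorithm X, ⨆ P ∈ 𝓟,
    expectation (sampleLaw P ℓ) fun S => excessRisk P H (A ℓ S (marginal P))

/-- Knowing the marginal helps to learn `H` over `𝓟`. -/
def MarginalHelps (H : Set (X → Bool)) (𝓟 : Set (ProbabilityMeasure (X × Bool))) : Prop :=
  Filter.Tendsto (fun ℓ : ℕ => minimaxMarginal H 𝓟 ℓ / minimaxSL H 𝓟 ℓ) Filter.atTop (nhds 0)

/-- `f` has rate `g`, for sample sizes `ℓ ≥ 1`. -/
def HasRate (f : ℕ → ℝ≥0∞) (g : ℕ → ℝ) : Prop :=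
  ∃ c₁ c₂ : ℝ, 0 < c₁ ∧ 0 < c₂ ∧ ∀ ℓ : ℕ, 1 ≤ ℓ →
    ENNReal.ofReal (c₁ * g ℓ) ≤ f ℓ ∧ f ℓ ≤ ENNReal.ofReal (c₂ * g ℓ)

/-- `P` consists of the marginal `μ` paired with the labeling function `η = P(Y = 1 | X = ·)`. -/
def IsPairing (P : ProbabilityMeasure (X × Bool)) (μ : Measure X) (η : X → ℝ) : Prop :=
  marginal P = μ ∧ ∀ B : Set X, MeasurableSet B →
    (P : Measure (X × Bool)) (B ×ˢ {true}) = ∫⁻ x in B, ENNReal.ofReal (η x) ∂μ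

/-- The labeling function that equals `1/2 + α` where `h ≠ h'` and agrees with `h` elsewhere. -/
def richLabeling {X : Type*} (h h' : X → Bool) (α : ℝ) (x : X) : ℝ :=
  if h x ≠ h' x then 1 / 2 + α else if h x = true then 1 else 0

/-- The family `𝓟` is rich for the class `H`. -/
def IsRich (𝓟 : Set (ProbabilityMeasure (X × Bool))) (H : Set (X → Bool)) : Prop :=
  ∃ h ∈ H, ∃ h' ∈ H, ∃ μ : ProbabilityMeasure X,
    (μ : Measure X) {x | h x ≠ h' x ∧ h x = false} ≠
      (μ : Measure X) {x | h x ≠ h' x ∧ h x = true} ∧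
    ∀ α : ℝ, 0 < α → α < 1 / 2 →
      (∃ P ∈ 𝓟, IsPairing P μ (richLabeling h h' α)) ∧
      (∃ P ∈ 𝓟, IsPairing P μ (richLabeling h h' (-α)))

end

end SSL

/-! Upper bound: empirical risk minimization has expected excess risk at most twice the expected
deviation, uniform over the class, between the losses on two independent samples, and symmetrization
turns that deviation into the Rademacher complexity of the losses on a double sample. A random
subsample of size logarithmic in the packing number separates the packing, so by the Sauer-Shelah
lemma the packing numbers at scale `ε` are polynomial in `1 / ε`; chaining over dyadic scales then
gives the rate `1 / √ℓ` without a logarithmic factor.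

Lower bound: `P_α` and `P_{-α}` have the same marginal, so a learner that is given the marginal
faces the same two-point testing problem as one that is not. For `α = 1 / (4 √ℓ)` the two sample
laws overlap by a constant, while the two risks of any classifier sum to at least the mass of the
region where `h` and `h'` disagree. Because `h = 0` and `h = 1` have different masses there, one of
`h`, `h'` beats half of that mass by a multiple of `α` under `P_α`, and the other one does so under
`P_{-α}`. -/

namespace SSL

open Metric Finset
open scoped NNReal Pointwise

theorem sum_le_card_mul_of_sum_exp_le {α : Type*} {s : Finset α} {f : α → ℝ} {L : ℝ}
    (h : ∑ a ∈ s, Real.exp (f a) ≤ #s * Real.exp L) : ∑ a ∈ s, f a ≤ #s * L := by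
  have hexp : ∑ a ∈ s, Real.exp (f a - L) ≤ #s := by
    simp only [Real.exp_sub, ← sum_div]
    rwa [div_le_iff₀ (Real.exp_pos L)]
  have htangent : ∑ a ∈ s, (f a - L + 1) ≤ ∑ a ∈ s, Real.exp (f a - L) :=
    sum_le_sum fun a _ => Real.add_one_le_exp _
  simp only [sum_add_distrib, sum_sub_distrib, sum_const, nsmul_eq_mul] at htangent
  linarith

section Rademacher

variable {ι : Type*} [Fintype ι]

/-- The vector with entries `1` and `-1` given by a choice of signs. -/
noncomputable def signVector (σ : ι → ℤˣ) : EuclideanSpace ℝ ι :=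
  WithLp.toLp 2 fun i => ((σ i : ℤ) : ℝ)

theorem inner_signVector (σ : ι → ℤˣ) (v : EuclideanSpace ℝ ι) :
    inner ℝ (signVector σ) v = ∑ i, ((σ i : ℤ) : ℝ) * v i := by
  simp [signVector, PiLp.inner_apply, mul_comm]

theorem norm_signVector (σ : ι → ℤˣ) : ‖signVector σ‖ = √(Fintype.card ι) := by
  simp [signVector, EuclideanSpace.norm_eq, ← Int.cast_pow, ← Units.val_pow_eq_pow_val]

variable [DecidableEq ι]

theorem sum_exp_inner_signVector_le (v : EuclideanSpace ℝ ι) :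
    ∑ σ : ι → ℤˣ, Real.exp (inner ℝ (signVector σ) v)
      ≤ 2 ^ Fintype.card ι * Real.exp (‖v‖ ^ 2 / 2) := by
  have hcosh : ∀ t : ℝ, ∑ s : ℤˣ, Real.exp (((s : ℤ) : ℝ) * t) = 2 * Real.cosh t := fun t => by
    rw [Real.cosh_eq]
    simp
    field_simp
  calc ∑ σ : ι → ℤˣ, Real.exp (inner ℝ (signVector σ) v)
      = ∏ i, 2 * Real.cosh (v i) := by
        simp_rw [inner_signVector, Real.exp_sum, ← hcosh, Fintype.prod_sum]
    _ ≤ ∏ i, 2 * Real.exp (v i ^ 2 / 2) := by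
        gcongr with i
        exact Real.cosh_le_exp_half_sq _
    _ = 2 ^ Fintype.card ι * Real.exp (‖v‖ ^ 2 / 2) := by
        rw [prod_mul_distrib, ← Real.exp_sum, ← sum_div, EuclideanSpace.real_norm_sq_eq]
        simp

theorem sum_exp_abs_inner_signVector_le (v : EuclideanSpace ℝ ι) :
    ∑ σ : ι → ℤˣ, Real.exp |inner ℝ (signVector σ) v|
      ≤ 2 ^ Fintype.card ι * (2 * Real.exp (‖v‖ ^ 2 / 2)) := by
  have hneg := sum_exp_inner_signVector_le (-v)
  rw [norm_neg] at hneg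
  calc ∑ σ : ι → ℤˣ, Real.exp |inner ℝ (signVector σ) v|
      ≤ ∑ σ : ι → ℤˣ, (Real.exp (inner ℝ (signVector σ) v)
          + Real.exp (inner ℝ (signVector σ) (-v))) := by
        gcongr with σ
        rw [inner_neg_right]
        exact Real.exp_abs_le _
    _ ≤ 2 ^ Fintype.card ι * (2 * Real.exp (‖v‖ ^ 2 / 2)) := by
        rw [sum_add_distrib]
        linarith [sum_exp_inner_signVector_le v]

/-- The (unnormalized) Rademacher complexity of a set of vectors: the expectation of
`sup_{v ∈ V} |∑ σᵢ vᵢ|` over independent uniform signs `σᵢ`. -/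
noncomputable def rademacherComplexity (V : Set (EuclideanSpace ℝ ι)) : ℝ≥0∞ :=
  (∑ σ : ι → ℤˣ, ⨆ v ∈ V, ‖inner ℝ (signVector σ) v‖ₑ) / 2 ^ Fintype.card ι

theorem rademacherComplexity_mono {V W : Set (EuclideanSpace ℝ ι)} (h : V ⊆ W) :
    rademacherComplexity V ≤ rademacherComplexity W :=
  ENNReal.div_le_div_right (sum_le_sum fun _ _ => biSup_mono fun _ hv => h hv) _

theorem rademacherComplexity_add_le (V W : Set (EuclideanSpace ℝ ι)) :
    rademacherComplexity (V + W) ≤ rademacherComplexity V + rademacherComplexity W := by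
  unfold rademacherComplexity
  rw [← ENNReal.add_div, ← sum_add_distrib]
  gcongr with σ
  refine iSup₂_le fun _ hx => ?_
  obtain ⟨v, hv, w, hw, rfl⟩ := Set.mem_add.1 hx
  rw [inner_add_right]
  exact (enorm_add_le _ _).trans (add_le_add (le_iSup₂_of_le v hv le_rfl)
    (le_iSup₂_of_le w hw le_rfl))

theorem rademacherComplexity_sum_le {κ : Type*} (s : Finset κ)
    (V : κ → Set (EuclideanSpace ℝ ι)) :
    rademacherComplexity (∑ k ∈ s, V k) ≤ ∑ k ∈ s, rademacherComplexity (V k) :=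
  le_sum_of_subadditive _ (by simp [rademacherComplexity]) rademacherComplexity_add_le s V

theorem rademacherComplexity_le_ofReal {V : Set (EuclideanSpace ℝ ι)} {M : (ι → ℤˣ) → ℝ}
    (hM : ∀ σ, 0 ≤ M σ) (hV : ∀ σ, ∀ v ∈ V, |inner ℝ (signVector σ) v| ≤ M σ) :
    rademacherComplexity V ≤ ENNReal.ofReal ((∑ σ, M σ) / 2 ^ Fintype.card ι) := by
  rw [ENNReal.ofReal_div_of_pos (by positivity), ENNReal.ofReal_sum_of_nonneg fun σ _ => hM σ,
    ENNReal.ofReal_pow zero_le_two, ENNReal.ofReal_ofNat, rademacherComplexity]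
  gcongr with σ
  refine iSup₂_le fun v hv => ?_
  rw [Real.enorm_eq_ofReal_abs]
  exact ENNReal.ofReal_le_ofReal (hV σ v hv)

theorem rademacherComplexity_closedBall_le {r : ℝ} (hr : 0 ≤ r) :
    rademacherComplexity (closedBall (0 : EuclideanSpace ℝ ι) r)
      ≤ ENNReal.ofReal (√(Fintype.card ι) * r) := by
  refine (rademacherComplexity_le_ofReal (M := fun _ => √(Fintype.card ι) * r)
    (fun _ => by positivity) fun σ v hv => ?_).trans (le_of_eq ?_)
  · rw [mem_closedBall_zero_iff] at hv
    refine (abs_real_inner_le_norm _ _).trans ?_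
    rw [norm_signVector]
    gcongr
  · simp

theorem rademacherComplexity_finset_le_add (F : Finset (EuclideanSpace ℝ ι)) {r t : ℝ}
    (ht : 0 < t) (hF : ∀ v ∈ F, ‖v‖ ≤ r) :
    rademacherComplexity (F : Set (EuclideanSpace ℝ ι))
      ≤ ENNReal.ofReal (Real.log (2 * #F) / t + t * r ^ 2 / 2) := by
  rcases F.eq_empty_or_nonempty with rfl | hne
  · simp [rademacherComplexity]
  have hcard : (0 : ℝ) < 2 * #F := by have := hne.card_pos; positivity
  set M : (ι → ℤˣ) → ℝ := fun σ => F.sup' hne fun v => |inner ℝ (signVector σ) v|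
  have hM : ∀ σ, ∀ v ∈ F, |inner ℝ (signVector σ) v| ≤ M σ := fun σ v hv =>
    le_sup' (fun v => |inner ℝ (signVector σ) v|) hv
  have hexp : ∀ σ, Real.exp (t * M σ) ≤ ∑ v ∈ F, Real.exp |inner ℝ (signVector σ) (t • v)| := by
    intro σ
    obtain ⟨v, hv, hvM⟩ := exists_mem_eq_sup' hne fun v => |inner ℝ (signVector σ) v|
    rw [show M σ = _ from hvM, ← abs_of_pos ht, ← abs_mul, abs_of_pos ht, ← real_inner_smul_right]
    exact single_le_sum (f := fun v => Real.exp |inner ℝ (signVector σ) (t • v)|)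
      (fun _ _ => by positivity) hv
  have hmoment : ∑ σ, Real.exp (t * M σ)
      ≤ 2 ^ Fintype.card ι * Real.exp (Real.log (2 * #F) + t ^ 2 * r ^ 2 / 2) := by
    calc ∑ σ, Real.exp (t * M σ)
        ≤ ∑ v ∈ F, ∑ σ, Real.exp |inner ℝ (signVector σ) (t • v)| := by
          rw [sum_comm]
          exact sum_le_sum fun σ _ => hexp σ
      _ ≤ ∑ _v ∈ F, 2 ^ Fintype.card ι * (2 * Real.exp (t ^ 2 * r ^ 2 / 2)) := by
          gcongr with v hv
          refine (sum_exp_abs_inner_signVector_le _).trans ?_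
          rw [norm_smul, Real.norm_of_nonneg ht.le, mul_pow]
          gcongr
          exact hF v hv
      _ = 2 ^ Fintype.card ι * Real.exp (Real.log (2 * #F) + t ^ 2 * r ^ 2 / 2) := by
          rw [Real.exp_add, Real.exp_log hcard, sum_const, nsmul_eq_mul]
          ring
  refine (rademacherComplexity_le_ofReal (fun σ => ?_) hM).trans (ENNReal.ofReal_le_ofReal ?_)
  · exact (abs_nonneg _).trans (hM σ _ hne.choose_spec)
  · have hmean := sum_le_card_mul_of_sum_exp_le (s := univ) (f := fun σ => t * M σ)
      (L := Real.log (2 * #F) + t ^ 2 * r ^ 2 / 2) (by simpa using hmoment)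
    rw [div_le_iff₀ (by positivity), ← mul_le_mul_iff_right₀ ht, mul_sum]
    refine hmean.trans_eq ?_
    simp
    field_simp

theorem rademacherComplexity_finset_le (F : Finset (EuclideanSpace ℝ ι)) {r : ℝ} (hr : 0 < r)
    (hF : ∀ v ∈ F, ‖v‖ ≤ r) :
    rademacherComplexity (F : Set (EuclideanSpace ℝ ι))
      ≤ ENNReal.ofReal (r * √(2 * Real.log (2 * #F))) := by
  rcases F.eq_empty_or_nonempty with rfl | hne
  · simp [rademacherComplexity]
  have hlog : 0 < Real.log (2 * #F) := Real.log_pos (by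
    have : (1 : ℝ) ≤ #F := by exact_mod_cast hne.card_pos
    linarith)
  set s := √(2 * Real.log (2 * #F))
  have hs : 0 < s := by positivity
  have hs2 : s ^ 2 = 2 * Real.log (2 * #F) := Real.sq_sqrt (by positivity)
  refine (rademacherComplexity_finset_le_add F (div_pos hs hr) hF).trans_eq ?_
  congr 1
  rw [show Real.log (2 * #F) = s ^ 2 / 2 by linarith]
  field_simp
  ring

end Rademacher

section Chaining

theorem subset_sum_links_add_closedBall {E : Type*} [SeminormedAddCommGroup E] {V : Set E}
    {N : ℕ → Set E} {r : ℕ → ℝ≥0} (hN₀ : N 0 = {0}) (hN : ∀ j, IsCover (r j) V (N j)) (J : ℕ) :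
    V ⊆ ∑ j ∈ range J, ((N (j + 1) - N j) ∩ closedBall 0 ((r (j + 1) : ℝ) + r j))
      + closedBall 0 (r J : ℝ) := by
  intro v hv
  have hnear : ∀ j, ∃ u ∈ N j, dist v u ≤ r j := fun j => by
    obtain ⟨u, hu, hvu⟩ := hN j hv
    exact ⟨u, hu, by simpa [edist_dist, ENNReal.ofReal_le_coe] using hvu⟩
  choose u huN hvu using hnear
  have hlinks : ∀ J, u J ∈ ∑ j ∈ range J,
      ((N (j + 1) - N j) ∩ closedBall 0 ((r (j + 1) : ℝ) + r j)) := by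
    intro J
    induction J with
    | zero => simpa [hN₀] using huN 0
    | succ J ih =>
      rw [sum_range_succ, ← add_sub_cancel (u J) (u (J + 1))]
      refine Set.add_mem_add ih ⟨Set.sub_mem_sub (huN _) (huN _), ?_⟩
      rw [mem_closedBall_zero_iff, ← dist_eq_norm]
      exact (dist_triangle_left _ _ v).trans (add_le_add (hvu _) (hvu _))
  rw [← add_sub_cancel (u J) v]
  refine Set.add_mem_add (hlinks J) ?_
  rw [mem_closedBall_zero_iff, ← dist_eq_norm]
  exact hvu J

theorem sum_geometric_mul_linear_le {a b : ℝ} (ha : 0 ≤ a) (hb : 0 ≤ b) (J : ℕ) :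
    ∑ j ∈ range J, (a * j + b) / 2 ^ (j + 1) ≤ a + b := by
  have hsum : ∑ j ∈ range J, (a * j + b) / 2 ^ (j + 1) = a + b - (a * (J + 1) + b) / 2 ^ J := by
    induction J with
    | zero => simp
    | succ J ih =>
      rw [sum_range_succ, ih]
      push_cast
      field_simp
      ring
  rw [hsum]
  have : 0 ≤ (a * (J + 1) + b) / 2 ^ J := by positivity
  linarith

variable {ι : Type*} [Fintype ι] [DecidableEq ι]

theorem rademacherComplexity_links_le {N N' : Finset (EuclideanSpace ℝ ι)} {r K : ℝ} (hr : 0 < r)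
    (hK : 1 ≤ K) (hcard : (#N * #N' : ℝ) ≤ K) :
    rademacherComplexity ((N - N' : Set (EuclideanSpace ℝ ι)) ∩ closedBall 0 r)
      ≤ ENNReal.ofReal (r * (Real.log K + 3 / 2)) := by
  classical
  set L := (N - N').filter (‖·‖ ≤ r)
  have hL : (N - N' : Set (EuclideanSpace ℝ ι)) ∩ closedBall 0 r = L := by
    ext v
    simp [L, ← coe_sub]
  have hLK : (#L : ℝ) ≤ K :=
    le_trans (by exact_mod_cast (card_filter_le _ _).trans card_sub_le) hcard
  have hlog : Real.log (2 * #L) ≤ Real.log K + 1 := by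
    rcases (#L).eq_zero_or_pos with h0 | hpos
    · simp only [h0, Nat.cast_zero, mul_zero, Real.log_zero]
      linarith [Real.log_nonneg hK]
    · calc Real.log (2 * #L) ≤ Real.log (2 * K) := by gcongr
        _ = Real.log 2 + Real.log K := Real.log_mul two_ne_zero (by positivity)
        _ ≤ Real.log K + 1 := by linarith [Real.log_two_lt_d9]
  rw [hL]
  refine (rademacherComplexity_finset_le L hr fun v hv => (mem_filter.1 hv).2).trans
    (ENNReal.ofReal_le_ofReal ?_)
  gcongr
  have hlogK := Real.log_nonneg hK
  calc √(2 * Real.log (2 * #L)) ≤ √((Real.log K + 3 / 2) ^ 2) := Real.sqrt_le_sqrt (by nlinarith)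
    _ = Real.log K + 3 / 2 := Real.sqrt_sq (by positivity)

theorem exists_finset_isCover_of_coveringNumber_le {E : Type*} [PseudoEMetricSpace E] {V : Set E}
    {ε : ℝ≥0} {n : ℕ} (h : coveringNumber ε V ≤ n) :
    ∃ N : Finset E, #N ≤ n ∧ IsCover ε V N := by
  have htop : coveringNumber ε V ≠ ⊤ := ne_top_of_le_ne_top (ENat.natCast_ne_top n) h
  refine ⟨(finite_minimalCover (ε := ε) (A := V)).toFinset, ?_, ?_⟩
  · rw [← encard_minimalCover htop, (finite_minimalCover).encard_eq_coe_toFinset_card] at h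
    exact_mod_cast h
  · simpa using isCover_minimalCover htop

theorem exists_nets_of_coveringNumber_le {E : Type*} [SeminormedAddCommGroup E] {V : Set E}
    {R : ℝ≥0} {K B : ℕ} (hK : 1 ≤ K) (hV : V ⊆ closedBall 0 R)
    (hcover : ∀ j : ℕ, coveringNumber (R / 2 ^ j) V ≤ (K * B ^ j : ℕ)) :
    ∃ N : ℕ → Finset E, N 0 = {0} ∧
      ∀ j, #(N j) ≤ K * B ^ j ∧ IsCover (R / 2 ^ j) V (N j : Set E) := by
  choose N hN using fun j => exists_finset_isCover_of_coveringNumber_le (hcover j)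
  refine ⟨fun j => if j = 0 then {0} else N j, rfl, fun j => ?_⟩
  rcases eq_or_ne j 0 with rfl | hj
  · refine ⟨by simpa using hK, fun v hv => ⟨0, by simp, ?_⟩⟩
    simpa [edist_eq_enorm_sub, enorm_le_coe, ← NNReal.coe_le_coe]
      using mem_closedBall_zero_iff.1 (hV hv)
  · simpa [hj] using hN j

theorem rademacherComplexity_dyadic_links_le {N : ℕ → Finset (EuclideanSpace ℝ ι)} {R : ℝ≥0}
    (hR : 0 < R) {K B : ℕ} (hK : 1 ≤ K) (hB : 1 ≤ B) (hN : ∀ j, #(N j) ≤ K * B ^ j) (j : ℕ) :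
    rademacherComplexity ((N (j + 1) - N j : Set (EuclideanSpace ℝ ι)) ∩
        closedBall 0 (((R / 2 ^ (j + 1) : ℝ≥0) : ℝ) + (R / 2 ^ j : ℝ≥0)))
      ≤ ENNReal.ofReal (3 * R * ((2 * Real.log B * j +
        (Real.log B + 2 * Real.log K + 3 / 2)) / 2 ^ (j + 1))) := by
  have hKB : 1 ≤ K * B ^ (j + 1) * (K * B ^ j) := Nat.one_le_iff_ne_zero.2 (by positivity)
  have hlog : Real.log (K * B ^ (j + 1) * (K * B ^ j))
      = 2 * Real.log K + (2 * j + 1) * Real.log B := by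
    rw [Real.log_mul, Real.log_mul, Real.log_mul, Real.log_pow, Real.log_pow] <;>
      first | positivity | (push_cast; ring)
  refine (rademacherComplexity_links_le (K := K * B ^ (j + 1) * (K * B ^ j)) (by positivity)
    (by exact_mod_cast hKB) (by exact_mod_cast Nat.mul_le_mul (hN _) (hN _))).trans_eq ?_
  rw [hlog]
  push_cast
  congr 1
  field_simp
  ring

theorem rademacherComplexity_le_of_coveringNumber_le {V : Set (EuclideanSpace ℝ ι)} {R : ℝ≥0}
    (hR : 0 < R) {K B : ℕ} (hK : 1 ≤ K) (hB : 1 ≤ B) (hV : V ⊆ closedBall 0 R)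
    (hcover : ∀ j : ℕ, coveringNumber (R / 2 ^ j) V ≤ (K * B ^ j : ℕ)) :
    rademacherComplexity V
      ≤ ENNReal.ofReal (R * (9 * Real.log B + 6 * Real.log K + 11 / 2)) := by
  obtain ⟨N, hN₀, hN⟩ := exists_nets_of_coveringNumber_le hK hV hcover
  set n := Fintype.card ι
  have hresidual : √n * (R / 2 ^ n : ℝ≥0) ≤ R := by
    have h2n : √n ≤ 2 ^ n := Real.sqrt_le_iff.2 ⟨by positivity, by
      rw [sq, ← mul_pow]
      exact_mod_cast (Nat.lt_pow_self (by norm_num)).le⟩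
    rw [NNReal.coe_div, NNReal.coe_pow, NNReal.coe_ofNat, mul_div_assoc',
      div_le_iff₀ (by positivity), mul_comm]
    gcongr
  calc rademacherComplexity V
      ≤ ∑ j ∈ range n, rademacherComplexity
            ((N (j + 1) - N j : Set (EuclideanSpace ℝ ι)) ∩
              closedBall 0 (((R / 2 ^ (j + 1) : ℝ≥0) : ℝ) + (R / 2 ^ j : ℝ≥0)))
          + rademacherComplexity (closedBall 0 ((R / 2 ^ n : ℝ≥0) : ℝ)) := by
        refine (rademacherComplexity_mono (subset_sum_links_add_closedBall
          (N := fun j => (N j : Set _)) (by simp [hN₀]) (fun j => (hN j).2) n)).trans ?_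
        exact (rademacherComplexity_add_le _ _).trans
          (add_le_add_left (rademacherComplexity_sum_le _ _) _)
    _ ≤ ENNReal.ofReal (3 * R * (2 * Real.log B + (Real.log B + 2 * Real.log K + 3 / 2)))
          + ENNReal.ofReal R := by
        refine add_le_add ((sum_le_sum fun j _ =>
          rademacherComplexity_dyadic_links_le hR hK hB (fun j => (hN j).1) j).trans ?_)
          ((rademacherComplexity_closedBall_le (by positivity)).trans
            (ENNReal.ofReal_le_ofReal hresidual))
        rw [← ENNReal.ofReal_sum_of_nonneg fun j _ => by positivity, ← mul_sum]
        gcongr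
        exact sum_geometric_mul_linear_le (by positivity) (by positivity) n
    _ = ENNReal.ofReal (R * (9 * Real.log B + 6 * Real.log K + 11 / 2)) := by
        rw [← ENNReal.ofReal_add (by positivity) (by positivity)]
        congr 1
        ring

end Chaining

section VC

section Traces

variable {X κ : Type*}

/-- The label patterns that the members of `H` realize on the points `x i`. -/
def traces (H : Set (X → Bool)) (x : κ → X) : Set (κ → Bool) := (· ∘ x) '' H

theorem card_le_of_shatters_traces {H : Set (X → Bool)} {d : ℕ}
    (hd : ∀ s : Finset X, Shatters H s → #s ≤ d) {x : κ → X} {s : Finset κ}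
    (hs : ∀ t ⊆ s, ∃ u ∈ traces H x, ∀ i ∈ s, (u i = true ↔ i ∈ t)) : #s ≤ d := by
  classical
  have hinj : Set.InjOn x s := by
    intro i hi j hj hij
    obtain ⟨_, ⟨h, _, rfl⟩, hu⟩ := hs {i} (by simpa using hi)
    have hxi : h (x i) = true := (hu i hi).2 (by simp)
    exact (mem_singleton.1 ((hu j hj).1 (show h (x j) = true from hij ▸ hxi))).symm
  rw [← card_image_of_injOn hinj]
  refine hd _ fun t _ => ?_
  obtain ⟨_, ⟨h, hh, rfl⟩, hu⟩ := hs (s.filter fun i => x i ∈ t) (filter_subset _ _)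
  refine ⟨h, hh, fun y hy => ?_⟩
  obtain ⟨i, hi, rfl⟩ := mem_image.1 hy
  simpa [hi] using hu i hi

variable [Fintype κ]

theorem card_le_two_mul_card_pow_of_vcDim_le [DecidableEq κ] [Nonempty κ]
    {𝒜 : Finset (Finset κ)} {d : ℕ} (h𝒜 : 𝒜.vcDim ≤ d) : #𝒜 ≤ (2 * Fintype.card κ) ^ d :=
  calc #𝒜 ≤ #𝒜.shatterer := card_le_card_shatterer _
    _ ≤ ∑ k ∈ Iic 𝒜.vcDim, (Fintype.card κ).choose k := card_shatterer_le_sum_vcDim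
    _ ≤ ∑ k ∈ Iic d, (Fintype.card κ).choose k := sum_le_sum_of_subset (Iic_subset_Iic.2 h𝒜)
    _ ≤ ∑ _k ∈ Iic d, Fintype.card κ ^ d := sum_le_sum fun k hk =>
        (Nat.choose_le_pow _ k).trans (Nat.pow_le_pow_right Fintype.card_pos (mem_Iic.1 hk))
    _ = (d + 1) * Fintype.card κ ^ d := by simp
    _ ≤ (2 * Fintype.card κ) ^ d := by
        rw [mul_pow]
        exact Nat.mul_le_mul_right _ Nat.lt_two_pow_self

theorem card_le_of_subset_traces [Nonempty κ] {H : Set (X → Bool)} {d : ℕ}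
    (hd : ∀ s : Finset X, Shatters H s → #s ≤ d) {x : κ → X} {U : Finset (κ → Bool)}
    (hU : (U : Set (κ → Bool)) ⊆ traces H x) : #U ≤ (2 * Fintype.card κ) ^ d := by
  classical
  let support (u : κ → Bool) : Finset κ := univ.filter fun i => u i = true
  have hinj : Function.Injective support := fun u w huw => by
    funext i
    exact Bool.eq_iff_iff.2 (by simpa [support] using Finset.ext_iff.1 huw i)
  rw [← card_image_of_injective U hinj]
  refine card_le_two_mul_card_pow_of_vcDim_le (Finset.sup_le fun s hs => ?_)
  refine card_le_of_shatters_traces hd (x := x) fun t ht => ?_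
  obtain ⟨_, hw, rfl⟩ := (mem_shatterer.1 hs) ht
  obtain ⟨u, hu, rfl⟩ := mem_image.1 hw
  exact ⟨u, hU hu, fun i hi => by simp [support, hi]⟩

end Traces

section Packing

variable {κ : Type*} [Fintype κ]

theorem card_comp_eq_comp {β : Type*} [DecidableEq β] (u w : κ → β) (m : ℕ) :
    #{f : Fin m → κ | u ∘ f = w ∘ f} = (Fintype.card κ - hammingDist u w) ^ m := by
  classical
  have hagree : #{i | u i = w i} = Fintype.card κ - hammingDist u w :=
    Nat.eq_sub_of_add_eq (card_filter_add_card_filter_not _)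
  rw [← hagree, ← Fintype.card_piFinset_const]
  congr 1
  ext f
  simp [funext_iff]

/-- Union bound: a random `m`-tuple of coordinates fails to separate a given pair with probability
at most `(1 - ε) ^ m`. -/
theorem exists_injOn_comp {β : Type*} [DecidableEq β] [Nonempty κ] {U : Finset (κ → β)} {ε : ℝ}
    {m : ℕ} (hε : ε ≤ 1) (hsep : ∀ u ∈ U, ∀ w ∈ U, u ≠ w → ε * Fintype.card κ ≤ hammingDist u w)
    (hlt : (#U : ℝ) ^ 2 * (1 - ε) ^ m < 1) :
    ∃ f : Fin m → κ, Set.InjOn (fun u : κ → β => u ∘ f) U := by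
  classical
  set N := Fintype.card κ
  let merging (q : (κ → β) × (κ → β)) : Finset (Fin m → κ) := {f | q.1 ∘ f = q.2 ∘ f}
  have hmerging : ∀ q ∈ U.offDiag, (#(merging q) : ℝ) ≤ ((1 - ε) * N) ^ m := by
    intro q hq
    obtain ⟨hu, hw, hne⟩ := mem_offDiag.1 hq
    rw [card_comp_eq_comp, Nat.cast_pow, Nat.cast_sub hammingDist_le_card_fintype]
    refine pow_le_pow_left₀ (sub_nonneg.2 (Nat.cast_le.2 hammingDist_le_card_fintype)) ?_ m
    linarith [hsep _ hu _ hw hne]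
  have hcard : #(U.offDiag.biUnion merging) < Fintype.card (Fin m → κ) := by
    rw [Fintype.card_fun, Fintype.card_fin, ← Nat.cast_lt (α := ℝ), Nat.cast_pow]
    calc (#(U.offDiag.biUnion merging) : ℝ) ≤ ∑ q ∈ U.offDiag, (#(merging q) : ℝ) := by
          exact_mod_cast card_biUnion_le
      _ ≤ #U.offDiag * ((1 - ε) * N) ^ m := by
          rw [← nsmul_eq_mul]
          exact sum_le_card_nsmul _ _ _ hmerging
      _ ≤ (#U ^ 2 * (1 - ε) ^ m) * N ^ m := by
          have hoff : (#U.offDiag : ℝ) ≤ #U ^ 2 := by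
            rw [offDiag_card, sq]
            exact_mod_cast Nat.sub_le _ _
          rw [mul_pow, ← mul_assoc]
          have := pow_nonneg (sub_nonneg.2 hε) m
          gcongr
      _ < N ^ m := mul_lt_of_lt_one_left (pow_pos (by exact_mod_cast Fintype.card_pos) m) hlt
  obtain ⟨f, hf⟩ : ∃ f, f ∉ U.offDiag.biUnion merging := by
    by_contra! hall
    exact hcard.ne (card_eq_iff_eq_univ _ |>.2 (eq_univ_of_forall hall))
  refine ⟨f, fun u hu w hw huw => by_contra fun hne => hf ?_⟩
  exact mem_biUnion.2 ⟨(u, w), mem_offDiag.2 ⟨hu, hw, hne⟩, by simpa [merging] using huw⟩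

theorem le_mul_of_le_log_pow {M ε : ℝ} (hM : 0 < M) (hε : 0 < ε) {d : ℕ}
    (h : M ≤ (2 * ((2 * Real.log (2 * M) + 1) / ε)) ^ d) (hlog : 0 ≤ Real.log (2 * M)) :
    M ≤ 4 * (2 * d).factorial * (4 / ε) ^ (2 * d) := by
  set x := 2 * Real.log (2 * M) + 1
  have hexp : (x / 2) ^ (2 * d) ≤ (2 * d).factorial * (4 * M) := by
    have hsqrt : Real.exp (x / 2) = Real.exp (1 / 2) * (2 * M) := by
      rw [show x / 2 = 1 / 2 + Real.log (2 * M) by ring, Real.exp_add, Real.exp_log (by positivity)]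
    have htwo : Real.exp (1 / 2) ≤ 2 := by
      refine (Real.exp_bound_div_one_sub_of_interval (by norm_num) (by norm_num)).trans ?_
      norm_num
    have := Real.pow_div_factorial_le_exp (x / 2) (by positivity) (2 * d)
    rw [div_le_iff₀' (by positivity), hsqrt] at this
    refine this.trans (mul_le_mul_of_nonneg_left ?_ (by positivity))
    linarith [mul_le_mul_of_nonneg_right htwo (show 0 ≤ 2 * M by positivity)]
  have hsq : M * M ≤ (4 * (2 * d).factorial * (4 / ε) ^ (2 * d)) * M := by
    calc M * M ≤ (2 * (x / ε)) ^ d * (2 * (x / ε)) ^ d := by gcongr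
      _ = (4 / ε) ^ (2 * d) * (x / 2) ^ (2 * d) := by
          rw [← mul_pow, ← mul_pow, pow_mul]
          congr 1
          ring
      _ ≤ (4 / ε) ^ (2 * d) * ((2 * d).factorial * (4 * M)) := by gcongr
      _ = _ := by ring
  exact le_of_mul_le_mul_right hsq hM

theorem sq_mul_one_sub_pow_lt_one {M ε : ℝ} (hM : 0 < M) (hε₀ : 0 < ε) (hε₁ : ε ≤ 1) {m : ℕ}
    (hm : 2 * Real.log (2 * M) / ε ≤ m) : M ^ 2 * (1 - ε) ^ m < 1 := by
  have hpow : (1 - ε) ^ m ≤ (2 * M)⁻¹ ^ 2 := by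
    calc (1 - ε) ^ m ≤ Real.exp (-ε) ^ m :=
          pow_le_pow_left₀ (by linarith) (Real.one_sub_le_exp_neg ε) m
      _ = Real.exp (-(ε * m)) := by rw [← Real.exp_nat_mul]; congr 1; ring
      _ ≤ Real.exp (-(2 * Real.log (2 * M))) :=
          Real.exp_le_exp.2 (neg_le_neg ((div_le_iff₀' hε₀).1 hm))
      _ = (2 * M)⁻¹ ^ 2 := by
          rw [← mul_neg, mul_comm, Real.exp_mul, ← Real.log_inv, Real.exp_log (by positivity)]
          norm_cast
  calc M ^ 2 * (1 - ε) ^ m ≤ M ^ 2 * (2 * M)⁻¹ ^ 2 := by gcongr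
    _ < 1 := by field_simp; norm_num

theorem card_le_of_hammingDist_separated {X : Type*} [Nonempty κ] {H : Set (X → Bool)} {d : ℕ}
    (hd : ∀ s : Finset X, Shatters H s → #s ≤ d) {x : κ → X} {U : Finset (κ → Bool)}
    (hU : (U : Set (κ → Bool)) ⊆ traces H x) {ε : ℝ} (hε₀ : 0 < ε) (hε₁ : ε ≤ 1)
    (hsep : ∀ u ∈ U, ∀ w ∈ U, u ≠ w → ε * Fintype.card κ ≤ hammingDist u w) :
    (#U : ℝ) ≤ 4 * (2 * d).factorial * (4 / ε) ^ (2 * d) := by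
  classical
  rcases U.eq_empty_or_nonempty with rfl | hne
  · simp only [card_empty, Nat.cast_zero]
    positivity
  have hU₁ : (1 : ℝ) ≤ #U := by exact_mod_cast hne.card_pos
  have hlog : 0 < Real.log (2 * #U) := Real.log_pos (by linarith)
  set m := ⌈2 * Real.log (2 * #U) / ε⌉₊
  have : Nonempty (Fin m) := Fin.pos_iff_nonempty.1 (Nat.ceil_pos.2 (by positivity))
  obtain ⟨f, hf⟩ := exists_injOn_comp hε₁ hsep
    (sq_mul_one_sub_pow_lt_one (by positivity) hε₀ hε₁ (Nat.le_ceil _))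
  have hsauer : #(U.image (· ∘ f)) ≤ (2 * Fintype.card (Fin m)) ^ d := by
    refine card_le_of_subset_traces hd (x := x ∘ f) ?_
    rw [coe_image]
    rintro _ ⟨u, hu, rfl⟩
    obtain ⟨h, hh, rfl⟩ := hU hu
    exact ⟨h, hh, rfl⟩
  rw [card_image_of_injOn hf, Fintype.card_fin] at hsauer
  have hm : (m : ℝ) ≤ (2 * Real.log (2 * #U) + 1) / ε := by
    refine (Nat.ceil_lt_add_one (by positivity)).le.trans ?_
    rw [add_div]
    gcongr
    exact (one_le_div hε₀).2 hε₁
  refine le_mul_of_le_log_pow (by positivity) hε₀ ?_ hlog.le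
  calc (#U : ℝ) ≤ (2 * m) ^ d := by exact_mod_cast hsauer
    _ ≤ _ := by gcongr

end Packing

end VC

section Symmetrization

variable {Z ι : Type*} [Fintype ι]

/-- The vectors of differences `f (zᵢ') - f (zᵢ)`, `f ∈ F`, along a double sample of pairs
`ωᵢ = (zᵢ, zᵢ')`. -/
def increments (F : Set (Z → ℝ)) (ω : ι → Z × Z) : Set (EuclideanSpace ℝ ι) :=
  (fun f => WithLp.toLp 2 fun i => f (ω i).2 - f (ω i).1) '' F

/-- The largest difference, over `f ∈ F`, between the sums of `f` over the two halves of a double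
sample. -/
noncomputable def ghostDeviation (F : Set (Z → ℝ)) (ω : ι → Z × Z) : ℝ≥0∞ :=
  ⨆ f ∈ F, ‖∑ i, f (ω i).2 - ∑ i, f (ω i).1‖ₑ

/-- The double sample in which the pairs with a negative sign are swapped. -/
def swapPairs (σ : ι → ℤˣ) (ω : ι → Z × Z) : ι → Z × Z :=
  fun i => if σ i = 1 then ω i else (ω i).swap

theorem ghostDeviation_swapPairs (F : Set (Z → ℝ)) (σ : ι → ℤˣ) (ω : ι → Z × Z) :
    ghostDeviation F (swapPairs σ ω)
      = ⨆ v ∈ increments F ω, ‖inner ℝ (signVector σ) v‖ₑ := by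
  have hswap : ∀ f : Z → ℝ, ∑ i, f (swapPairs σ ω i).2 - ∑ i, f (swapPairs σ ω i).1
      = ∑ i, ((σ i : ℤ) : ℝ) * (f (ω i).2 - f (ω i).1) := fun f => by
    rw [← sum_sub_distrib]
    refine sum_congr rfl fun i _ => ?_
    rcases Int.units_eq_one_or (σ i) with h | h <;> simp [swapPairs, h]
  simp only [ghostDeviation, increments, iSup_image, inner_signVector, hswap]

theorem rademacherComplexity_increments [DecidableEq ι] (F : Set (Z → ℝ)) (ω : ι → Z × Z) :
    rademacherComplexity (increments F ω)
      = (∑ σ, ghostDeviation F (swapPairs σ ω)) / 2 ^ Fintype.card ι := by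
  simp only [rademacherComplexity, ghostDeviation_swapPairs]

variable [MeasurableSpace Z] {P : Measure Z} [SigmaFinite P]

theorem measurePreserving_swapPairs (σ : ι → ℤˣ) :
    MeasurePreserving (swapPairs σ) (Measure.pi fun _ : ι => P.prod P)
      (Measure.pi fun _ => P.prod P) := by
  refine measurePreserving_pi (f := fun i p => if σ i = 1 then p else Prod.swap p) _ _ fun i => ?_
  split_ifs
  exacts [MeasurePreserving.id _, Measure.measurePreserving_swap]

/-- Swapping the members of the pairs preserves the law of the double sample, so the deviation may
be averaged over all swaps. -/
theorem lintegral_ghostDeviation [DecidableEq ι] {F : Set (Z → ℝ)}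
    (hF : AEMeasurable (ghostDeviation F) (Measure.pi fun _ : ι => P.prod P)) :
    ∫⁻ ω, ghostDeviation F ω ∂(Measure.pi fun _ : ι => P.prod P)
      = ∫⁻ ω, rademacherComplexity (increments F ω) ∂(Measure.pi fun _ : ι => P.prod P) := by
  have hswap := fun σ : ι → ℤˣ => measurePreserving_swapPairs (P := P) σ
  have hmeas : ∀ σ : ι → ℤˣ, AEMeasurable (fun ω => ghostDeviation F (swapPairs σ ω))
      (Measure.pi fun _ => P.prod P) := fun σ =>
    hF.comp_quasiMeasurePreserving (hswap σ).quasiMeasurePreserving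
  have hinv : ∀ σ : ι → ℤˣ, ∫⁻ ω, ghostDeviation F (swapPairs σ ω) ∂(Measure.pi fun _ => P.prod P)
      = ∫⁻ ω, ghostDeviation F ω ∂(Measure.pi fun _ => P.prod P) := fun σ => by
    rw [← lintegral_map' (by rwa [(hswap σ).map_eq]) (hswap σ).aemeasurable, (hswap σ).map_eq]
  simp only [rademacherComplexity_increments, div_eq_mul_inv]
  rw [lintegral_mul_const'' _ (Finset.aemeasurable_fun_sum _ fun σ _ => hmeas σ),
    lintegral_finsetSum' _ fun σ _ => hmeas σ]
  simp only [hinv, sum_const, nsmul_eq_mul, card_univ, Fintype.card_fun, Fintype.card_units_int]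
  rw [Nat.cast_pow, Nat.cast_ofNat, mul_comm, ← mul_assoc,
    ENNReal.inv_mul_cancel (by positivity) (by finiteness), one_mul]

end Symmetrization

section UniformDeviation

section Packing

variable {X : Type*} {κ : Type*} [Fintype κ]

theorem packingNumber_image_traces_le [Nonempty κ] {E : Type*} [SeminormedAddCommGroup E]
    {H : Set (X → Bool)} {d : ℕ} (hd : ∀ s : Finset X, Shatters H s → #s ≤ d) (x : κ → X)
    {g : (κ → Bool) → E} (hg : ∀ u w, ‖g u - g w‖ ^ 2 ≤ 2 * hammingDist u w) {δ : ℝ≥0} {ε : ℝ}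
    (hε₀ : 0 < ε) (hε₁ : ε ≤ 1) (hδ : 2 * (ε * Fintype.card κ) ≤ δ ^ 2) {n : ℕ}
    (hn : 4 * (2 * d).factorial * (4 / ε) ^ (2 * d) ≤ (n : ℝ)) :
    packingNumber δ (g '' traces H x) ≤ n := by
  classical
  refine iSup_le fun C => iSup₂_le fun hC hCsep => ?_
  obtain ⟨U, hUsub, hU⟩ := (Set.SurjOn.mono (subset_refl _) hC
    (Set.surjOn_image g (traces H x))).exists_bijOn_subset
  rw [← hU.image_eq, hU.injOn.encard_image, ← U.coe_toFinset, Set.encard_coe_eq_coe_finsetCard]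
  suffices (#U.toFinset : ℝ) ≤ n by exact_mod_cast this
  refine (card_le_of_hammingDist_separated hd (by simpa using hUsub) hε₀ hε₁ ?_).trans hn
  intro u hu w hw huw
  rw [Set.mem_toFinset] at hu hw
  have hsep : (δ : ℝ) < ‖g u - g w‖ := by
    have h : (δ : ℝ≥0∞) < edist (g u) (g w) :=
      hCsep (hU.mapsTo hu) (hU.mapsTo hw) fun h => huw (hU.injOn hu hw h)
    rwa [edist_eq_enorm_sub, ← ofReal_norm, ← ENNReal.ofReal_coe_nnreal,
      ENNReal.ofReal_lt_ofReal_iff_of_nonneg δ.coe_nonneg] at h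
  have hsq : (δ : ℝ) ^ 2 ≤ ‖g u - g w‖ ^ 2 := pow_le_pow_left₀ δ.coe_nonneg hsep.le 2
  linarith [hg u w]

end Packing

section Loss

variable {X ι : Type*}

/-- The zero-one loss of a classifier, as a real function of a labeled point. -/
def zeroOneLoss (h : X → Bool) (z : X × Bool) : ℝ := if h z.1 = z.2 then 0 else 1

theorem zeroOneLoss_nonneg (h : X → Bool) (z : X × Bool) : 0 ≤ zeroOneLoss h z := by
  unfold zeroOneLoss
  positivity

/-- The feature parts of a double sample, as a single family of points. -/
def features (ω : ι → (X × Bool) × (X × Bool)) : ι ⊕ ι → X :=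
  Sum.elim (fun i => (ω i).1.1) fun i => (ω i).2.1

/-- The increments of the zero-one loss of a classifier along a double sample, in terms of its
label pattern on the features. -/
def lossIncrement (ω : ι → (X × Bool) × (X × Bool)) (u : ι ⊕ ι → Bool) : EuclideanSpace ℝ ι :=
  WithLp.toLp 2 fun i =>
    (if u (.inr i) = (ω i).2.2 then 0 else 1) - (if u (.inl i) = (ω i).1.2 then 0 else 1)

theorem increments_zeroOneLoss (H : Set (X → Bool)) (ω : ι → (X × Bool) × (X × Bool)) :
    increments (zeroOneLoss '' H) ω = lossIncrement ω '' traces H (features ω) := by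
  simp only [increments, traces, Set.image_image]
  rfl

variable [Fintype ι]

theorem norm_lossIncrement_sub_sq_le (ω : ι → (X × Bool) × (X × Bool)) (u w : ι ⊕ ι → Bool) :
    ‖lossIncrement ω u - lossIncrement ω w‖ ^ 2 ≤ 2 * hammingDist u w := by
  have hcard : (hammingDist u w : ℝ) = ∑ i, ((if u (.inl i) = w (.inl i) then (0 : ℝ) else 1) +
      if u (.inr i) = w (.inr i) then 0 else 1) := by
    simp only [hammingDist, card_filter, Fintype.sum_sum_type, sum_add_distrib]
    simp
  rw [EuclideanSpace.real_norm_sq_eq, hcard, mul_sum]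
  refine sum_le_sum fun i _ => ?_
  simp only [lossIncrement, PiLp.sub_apply]
  rcases u (.inl i) <;> rcases u (.inr i) <;> rcases w (.inl i) <;> rcases w (.inr i) <;>
    rcases (ω i).1.2 <;> rcases (ω i).2.2 <;> norm_num

theorem norm_lossIncrement_le (ω : ι → (X × Bool) × (X × Bool)) (u : ι ⊕ ι → Bool) :
    ‖lossIncrement ω u‖ ≤ √(Fintype.card ι) := by
  rw [EuclideanSpace.norm_eq]
  gcongr
  calc ∑ i, ‖lossIncrement ω u i‖ ^ 2 ≤ ∑ _i : ι, (1 : ℝ) := by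
        gcongr with i
        simp only [lossIncrement]
        split_ifs <;> norm_num
    _ = Fintype.card ι := by simp

/-- The constant in the uniform deviation bound for a class of VC dimension `d`. It comes from
packing numbers at most `4 (2d)! 256 ^ d * (16 ^ d) ^ j` at scale `2⁻ʲ`. -/
noncomputable def vcConstant (d : ℕ) : ℝ :=
  9 * Real.log (16 ^ d : ℕ) + 6 * Real.log (4 * (2 * d).factorial * 256 ^ d : ℕ) + 11 / 2

theorem vcConstant_pos (d : ℕ) : 0 < vcConstant d := by
  unfold vcConstant
  positivity

theorem rademacherComplexity_increments_zeroOneLoss_le [DecidableEq ι] [Nonempty ι]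
    {H : Set (X → Bool)} {d : ℕ} (hd : ∀ s : Finset X, Shatters H s → #s ≤ d)
    (ω : ι → (X × Bool) × (X × Bool)) :
    rademacherComplexity (increments (zeroOneLoss '' H) ω)
      ≤ ENNReal.ofReal (√(Fintype.card ι) * vcConstant d) := by
  have hR : (NNReal.sqrt (Fintype.card ι) : ℝ) = √(Fintype.card ι) := by simp
  rw [increments_zeroOneLoss, ← hR]
  refine rademacherComplexity_le_of_coveringNumber_le
    (NNReal.sqrt_pos.2 (by exact_mod_cast Fintype.card_pos))
    (Nat.one_le_iff_ne_zero.2 (by positivity)) (Nat.one_le_iff_ne_zero.2 (by positivity)) ?_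
    fun j => (coveringNumber_le_packingNumber _ _).trans <|
        packingNumber_image_traces_le hd _ (norm_lossIncrement_sub_sq_le ω)
          (ε := (1 / 4) ^ (j + 1)) (by positivity) (pow_le_one₀ (by norm_num) (by norm_num)) ?_ ?_
  · rintro _ ⟨u, -, rfl⟩
    rw [mem_closedBall_zero_iff, hR]
    exact norm_lossIncrement_le ω u
  · rw [Fintype.card_sum]
    push_cast
    rw [div_pow, div_pow, Real.sq_sqrt (Nat.cast_nonneg _), ← pow_mul, mul_comm j, pow_mul]
    norm_num [pow_succ]
    apply le_of_eq
    field_simp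
    norm_num
  · push_cast
    have hscale : (4 / (1 / 4) ^ (j + 1) : ℝ) ^ (2 * d) = 256 ^ d * (16 ^ d) ^ j :=
      calc _ = ((4 : ℝ) ^ (j + 2)) ^ (2 * d) := by
            rw [one_div_pow, div_div_eq_mul_div, div_one, ← pow_succ']
        _ = (4 ^ 4) ^ d * ((4 ^ 2) ^ d) ^ j := by
            simp only [← pow_mul, ← pow_add]
            congr 1
            ring
        _ = 256 ^ d * (16 ^ d) ^ j := by norm_num
    rw [hscale]
    apply le_of_eq
    ring

end Loss

end UniformDeviation

section Measurability

variable {X : Type*}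

theorem aemeasurable_iSup_traces {Ω κ : Type*} [MeasurableSpace Ω] [Finite κ] {ν : Measure Ω}
    {H : Set (X → Bool)} {x : Ω → κ → X} {φ : (κ → Bool) → Ω → ℝ≥0∞}
    (hx : ∀ b, NullMeasurableSet {ω | b ∈ traces H (x ω)} ν) (hφ : ∀ b, AEMeasurable (φ b) ν) :
    AEMeasurable (fun ω => ⨆ b ∈ traces H (x ω), φ b ω) ν := by
  classical
  have hind : ∀ ω, (⨆ b ∈ traces H (x ω), φ b ω)
      = ⨆ b, {ω | b ∈ traces H (x ω)}.indicator (φ b) ω := fun ω => by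
    simp [Set.indicator_apply, iSup_eq_if]
  rw [funext hind]
  exact AEMeasurable.iSup fun b => (hφ b).indicator₀ (hx b)

variable [MeasurableSpace X]

theorem nullMeasurableSet_mem_traces {κ : Type*} [Fintype κ] {μ : Measure X} [SigmaFinite μ]
    {H : Set (X → Bool)} (hH : IsMeasurableClass H μ) (b : κ → Bool) :
    NullMeasurableSet {x : κ → X | b ∈ traces H x} (Measure.pi fun _ => μ) := by
  let e := Fintype.equivFin κ
  have hpre : {x : κ → X | b ∈ traces H x} = (fun x : κ → X => x ∘ e.symm) ⁻¹'
      {x | ∃ h ∈ H, ∀ i, h (x i) = (b ∘ e.symm) i} := by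
    ext x
    simp only [traces, Set.mem_image, funext_iff, Set.mem_ofPred_eq, Set.mem_preimage,
      Function.comp_apply, e.symm.forall_congr_left, Equiv.symm_symm, Equiv.symm_apply_apply]
  rw [hpre]
  refine (hH _ _).preimage (MeasurePreserving.quasiMeasurePreserving ?_)
  exact measurePreserving_arrowCongr' (fun _ => μ) (fun _ => μ) e (.refl X)
    fun _ => MeasurePreserving.id μ

variable {ι : Type*} [Fintype ι]

theorem measurePreserving_features (P : Measure (X × Bool)) [IsProbabilityMeasure P] :
    MeasurePreserving features (Measure.pi fun _ : ι => P.prod P)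
      (Measure.pi fun _ : ι ⊕ ι => P.fst) := by
  have hmeas : Measurable (features : (ι → (X × Bool) × (X × Bool)) → ι ⊕ ι → X) := by
    refine measurable_pi_iff.2 ?_
    rintro (i | i) <;> simp only [features, Sum.elim_inl, Sum.elim_inr] <;> fun_prop
  refine ⟨hmeas, (Measure.pi_eq fun s hs => ?_).symm⟩
  have hpre : features ⁻¹' Set.univ.pi s = Set.univ.pi fun i : ι =>
      (Prod.fst ⁻¹' s (.inl i)) ×ˢ (Prod.fst ⁻¹' s (.inr i) : Set (X × Bool)) := by
    ext ω
    simp [features, forall_and]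
  rw [Measure.map_apply hmeas (MeasurableSet.univ_pi hs), hpre, Measure.pi_pi]
  simp only [Measure.prod_prod, prod_mul_distrib, Fintype.prod_sum_type, Measure.fst_apply (hs _)]

omit [Fintype ι] in
theorem measurable_lossIncrement_apply (u : ι ⊕ ι → Bool) (i : ι) :
    Measurable fun ω : ι → (X × Bool) × (X × Bool) => lossIncrement ω u i := by
  have hne : ∀ b : Bool, Measurable fun y : Bool => if b = y then (0 : ℝ) else 1 :=
    fun b => measurable_of_finite _
  exact ((hne _).comp (by fun_prop)).sub ((hne _).comp (by fun_prop))

theorem aemeasurable_ghostDeviation_zeroOneLoss {P : Measure (X × Bool)} [IsProbabilityMeasure P]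
    {H : Set (X → Bool)} (hH : IsMeasurableClass H P.fst) :
    AEMeasurable (ghostDeviation (zeroOneLoss '' H)) (Measure.pi fun _ : ι => P.prod P) := by
  have hdev : ghostDeviation (zeroOneLoss '' H) = fun ω : ι → (X × Bool) × (X × Bool) =>
      ⨆ b ∈ traces H (features ω), ‖∑ i, lossIncrement ω b i‖ₑ := by
    funext ω
    simp only [ghostDeviation, traces, iSup_image, ← sum_sub_distrib]
    rfl
  rw [hdev]
  refine aemeasurable_iSup_traces (fun b => ?_) fun b => ?_
  · exact (nullMeasurableSet_mem_traces hH b).preimage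
      (measurePreserving_features P).quasiMeasurePreserving
  · exact (Finset.measurable_fun_sum _
      fun i _ => measurable_lossIncrement_apply b i).enorm.aemeasurable

theorem lintegral_ghostDeviation_zeroOneLoss_le [Nonempty ι] {P : Measure (X × Bool)}
    [IsProbabilityMeasure P] {H : Set (X → Bool)} (hH : IsMeasurableClass H P.fst) {d : ℕ}
    (hd : ∀ s : Finset X, Shatters H s → #s ≤ d) :
    ∫⁻ ω, ghostDeviation (zeroOneLoss '' H) ω ∂(Measure.pi fun _ : ι => P.prod P)
      ≤ ENNReal.ofReal (√(Fintype.card ι) * vcConstant d) := by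
  classical
  rw [lintegral_ghostDeviation (aemeasurable_ghostDeviation_zeroOneLoss hH)]
  refine (lintegral_mono fun ω => rademacherComplexity_increments_zeroOneLoss_le hd ω).trans ?_
  simp

end Measurability

section EmpiricalRisk

variable {X : Type*} [MeasurableSpace X] {H : Set (X → Bool)}

theorem expectation_le_lintegral {Ω : Type*} [MeasurableSpace Ω] {μ : Measure Ω}
    {f g : Ω → ℝ≥0∞} (hg : AEMeasurable g μ) (hfg : f ≤ g) :
    expectation μ f ≤ ∫⁻ ω, g ω ∂μ := by
  set N := toMeasurable μ {ω | g ω ≠ hg.mk g ω}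
  have hN : ∀ ω, ω ∉ N → g ω = hg.mk g ω := fun ω hω =>
    not_not.1 fun h => hω (subset_toMeasurable μ _ h)
  have hNnull : μ N = 0 := (measure_toMeasurable _).trans hg.ae_eq_mk
  have hG : ∀ ω, g ω ≤ hg.mk g ω + N.indicator ⊤ ω := fun ω => by
    by_cases hω : ω ∈ N <;> simp [hω, hN]
  calc expectation μ f ≤ ∫⁻ ω, (hg.mk g ω + N.indicator ⊤ ω) ∂μ :=
        iInf_le_of_le _ <| iInf_le_of_le (hg.measurable_mk.add
          (measurable_const.indicator (measurableSet_toMeasurable _ _))) <|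
          iInf_le_of_le (fun ω => (hfg ω).trans (hG ω)) le_rfl
    _ = ∫⁻ ω, g ω ∂μ := by
        refine lintegral_congr_ae ?_
        filter_upwards [hg.ae_eq_mk, measure_eq_zero_iff_ae_notMem.1 hNnull] with ω hω hωN
        simp [hω, hωN]

theorem excessRisk_le {P : ProbabilityMeasure (X × Bool)} {f : X → Bool} {c : ℝ≥0∞}
    (hc : ∀ h ∈ H, risk P f ≤ risk P h + c) : excessRisk P H f ≤ c := by
  rw [excessRisk, tsub_le_iff_left, bestRisk, ENNReal.iInf₂_add]
  exact le_iInf₂ hc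

theorem measurable_zeroOneLoss {h : X → Bool} (hh : Measurable h) : Measurable (zeroOneLoss h) :=
  Measurable.ite (measurableSet_eq_fun (hh.comp measurable_fst) measurable_snd) measurable_const
    measurable_const

theorem lintegral_sum_zeroOneLoss (P : ProbabilityMeasure (X × Bool)) {n : ℕ} {h : X → Bool}
    (hh : Measurable h) :
    ∫⁻ S, ENNReal.ofReal (∑ i, zeroOneLoss h (S i)) ∂(sampleLaw P n) = n * risk P h := by
  have hmeas : MeasurableSet {z : X × Bool | h z.1 ≠ z.2} :=
    (measurableSet_eq_fun (hh.comp measurable_fst) measurable_snd).compl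
  have hloss : (fun z => ENNReal.ofReal (zeroOneLoss h z)) = {z | h z.1 ≠ z.2}.indicator 1 := by
    funext z
    by_cases hz : h z.1 = z.2 <;> simp [zeroOneLoss, hz]
  have hrisk : ∫⁻ z, ENNReal.ofReal (zeroOneLoss h z) ∂P = risk P h := by
    rw [hloss, lintegral_indicator_one hmeas, risk]
  have heval : ∀ i : Fin n, ∫⁻ S, ENNReal.ofReal (zeroOneLoss h (S i)) ∂(sampleLaw P n)
      = risk P h := fun i =>
    ((measurePreserving_eval (fun _ => (P : Measure (X × Bool))) i).lintegral_comp
      (measurable_zeroOneLoss hh).ennreal_ofReal).trans hrisk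
  simp only [ENNReal.ofReal_sum_of_nonneg fun _ _ => zeroOneLoss_nonneg h _]
  rw [lintegral_finsetSum
    (f := fun i (S : Fin n → X × Bool) => ENNReal.ofReal (zeroOneLoss h (S i))) _
    fun i _ => ((measurable_zeroOneLoss hh).comp (measurable_pi_apply i)).ennreal_ofReal]
  simp only [heval, sum_const, card_univ, Fintype.card_fin, nsmul_eq_mul]

omit [MeasurableSpace X] in
theorem sum_zeroOneLoss_le_add_ghostDeviation {ι : Type*} [Fintype ι] {f h : X → Bool} (hf : f ∈ H)
    (hh : h ∈ H) {S : ι → X × Bool} (hle : ∑ i, zeroOneLoss f (S i) ≤ ∑ i, zeroOneLoss h (S i))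
    (S' : ι → X × Bool) :
    ENNReal.ofReal (∑ i, zeroOneLoss f (S' i)) ≤ ENNReal.ofReal (∑ i, zeroOneLoss h (S' i))
      + 2 * ghostDeviation (zeroOneLoss '' H) fun i => (S i, S' i) := by
  have hdev : ∀ g ∈ H, ENNReal.ofReal |∑ i, zeroOneLoss g (S' i) - ∑ i, zeroOneLoss g (S i)|
      ≤ ghostDeviation (zeroOneLoss '' H) fun i => (S i, S' i) := fun g hg => by
    rw [← Real.enorm_eq_ofReal_abs]
    exact le_iSup₂_of_le (zeroOneLoss g) ⟨g, hg, rfl⟩ le_rfl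
  rw [two_mul]
  refine le_trans ?_ (add_le_add_right (add_le_add (hdev f hf) (hdev h hh)) _)
  rw [← ENNReal.ofReal_add (abs_nonneg _) (abs_nonneg _),
    ← ENNReal.ofReal_add (sum_nonneg fun i _ => zeroOneLoss_nonneg h _) (by positivity)]
  refine ENNReal.ofReal_le_ofReal ?_
  linarith [le_abs_self (∑ i, zeroOneLoss f (S' i) - ∑ i, zeroOneLoss f (S i)),
    neg_abs_le (∑ i, zeroOneLoss h (S' i) - ∑ i, zeroOneLoss h (S i))]

omit [MeasurableSpace X] in
theorem exists_empiricalRiskMinimizer {ι : Type*} [Fintype ι] (hH : H.Nonempty)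
    (S : ι → X × Bool) :
    ∃ f ∈ H, ∀ h ∈ H, ∑ i, zeroOneLoss f (S i) ≤ ∑ i, zeroOneLoss h (S i) := by
  obtain ⟨_, ⟨f, hf, rfl⟩, hmin⟩ := Set.exists_min_image (traces H fun i => (S i).1)
    (fun u => ∑ i, if u i = (S i).2 then (0 : ℝ) else 1) (Set.toFinite _) (hH.image _)
  exact ⟨f, hf, fun h hh => hmin _ ⟨h, hh, rfl⟩⟩

theorem mul_risk_le_add_lintegral_ghostDeviation (P : ProbabilityMeasure (X × Bool))
    {f h : X → Bool} (hf : f ∈ H) (hh : h ∈ H) (hfm : Measurable f) (hhm : Measurable h) {n : ℕ}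
    {S : Fin n → X × Bool} (hle : ∑ i, zeroOneLoss f (S i) ≤ ∑ i, zeroOneLoss h (S i)) :
    n * risk P f ≤ n * risk P h
      + 2 * ∫⁻ S', ghostDeviation (zeroOneLoss '' H) (fun i => (S i, S' i)) ∂(sampleLaw P n) := by
  rw [← lintegral_sum_zeroOneLoss P hfm, ← lintegral_sum_zeroOneLoss P hhm,
    ← lintegral_const_mul' _ _ ENNReal.ofNat_ne_top, ← lintegral_add_left]
  · exact lintegral_mono fun S' => sum_zeroOneLoss_le_add_ghostDeviation hf hh hle S'
  · exact (Finset.measurable_fun_sum _ fun i _ =>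
      (measurable_zeroOneLoss hhm).comp (measurable_pi_apply i)).ennreal_ofReal

theorem lintegral_lintegral_pi_prod {ι Z : Type*} [Fintype ι] [MeasurableSpace Z] {P : Measure Z}
    [SigmaFinite P] {g : (ι → Z × Z) → ℝ≥0∞}
    (hg : AEMeasurable g (Measure.pi fun _ : ι => P.prod P)) :
    AEMeasurable (fun S : ι → Z => ∫⁻ S', g (fun i => (S i, S' i)) ∂(Measure.pi fun _ : ι => P))
        (Measure.pi fun _ : ι => P) ∧
      ∫⁻ S, ∫⁻ S', g (fun i => (S i, S' i)) ∂(Measure.pi fun _ : ι => P) ∂(Measure.pi fun _ => P)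
        = ∫⁻ ω, g ω ∂(Measure.pi fun _ => P.prod P) := by
  have hzip := (measurePreserving_arrowProdEquivProdArrow Z Z ι (fun _ => P) fun _ => P).symm
  have hcomp := hg.comp_quasiMeasurePreserving hzip.quasiMeasurePreserving
  refine ⟨hcomp.lintegral_prod_right', ?_⟩
  rw [← hzip.map_eq, lintegral_map' (by rwa [hzip.map_eq]) hzip.aemeasurable]
  exact (lintegral_prod _ hcomp).symm

theorem expectation_excessRisk_le {P : ProbabilityMeasure (X × Bool)}
    (hmeas : ∀ h ∈ H, Measurable h) (hclass : IsMeasurableClass H (marginal P)) {n : ℕ}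
    (hn : n ≠ 0) {f : (Fin n → X × Bool) → X → Bool} (hf : ∀ S, f S ∈ H)
    (hmin : ∀ S, ∀ h ∈ H, ∑ i, zeroOneLoss (f S) (S i) ≤ ∑ i, zeroOneLoss h (S i)) :
    expectation (sampleLaw P n) (fun S => excessRisk P H (f S))
      ≤ 2 / n * ∫⁻ ω, ghostDeviation (zeroOneLoss '' H) ω
          ∂(Measure.pi fun _ : Fin n => (P : Measure (X × Bool)).prod P) := by
  have hn₀ : (n : ℝ≥0∞) ≠ 0 := Nat.cast_ne_zero.2 hn
  obtain ⟨hG, hGint⟩ :=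
    lintegral_lintegral_pi_prod (aemeasurable_ghostDeviation_zeroOneLoss (ι := Fin n) hclass)
  rw [← hGint, ← lintegral_const_mul'' _ hG]
  refine expectation_le_lintegral (hG.const_mul _) fun S => excessRisk_le fun h hh => ?_
  have hrisk := mul_risk_le_add_lintegral_ghostDeviation P (hf S) hh (hmeas _ (hf S)) (hmeas h hh)
    (hmin S h hh)
  rw [← ENNReal.mul_le_mul_iff_right hn₀ (ENNReal.natCast_ne_top n), mul_add, ← mul_assoc,
    ENNReal.mul_div_cancel hn₀ (ENNReal.natCast_ne_top n)]
  exact hrisk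

theorem minimaxSL_le {𝓟 : Set (ProbabilityMeasure (X × Bool))} (hH : H.Nonempty)
    (hmeas : ∀ h ∈ H, Measurable h) (hclass : ∀ P ∈ 𝓟, IsMeasurableClass H (marginal P)) {d : ℕ}
    (hd : ∀ s : Finset X, Shatters H s → #s ≤ d) {n : ℕ} (hn : n ≠ 0) :
    minimaxSL H 𝓟 n ≤ ENNReal.ofReal (2 * vcConstant d * (1 / √n)) := by
  have : NeZero n := ⟨hn⟩
  choose erm herm hmin using
    fun (m : ℕ) (S : Fin m → X × Bool) => exists_empiricalRiskMinimizer hH S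
  refine iInf_le_of_le erm (iSup₂_le fun P hP => ?_)
  calc expectation (sampleLaw P n) (fun S => excessRisk P H (erm n S))
      ≤ 2 / n * ENNReal.ofReal (√n * vcConstant d) := by
        refine (expectation_excessRisk_le hmeas (hclass P hP) hn (herm n) (hmin n)).trans ?_
        gcongr
        simpa using lintegral_ghostDeviation_zeroOneLoss_le (ι := Fin n) (hclass P hP) hd
    _ = ENNReal.ofReal (2 * vcConstant d * (1 / √n)) := by
        have hpos : (0 : ℝ) < n := by positivity
        rw [← ENNReal.ofReal_ofNat, ← ENNReal.ofReal_natCast, ← ENNReal.ofReal_div_of_pos hpos,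
          ← ENNReal.ofReal_mul (by positivity)]
        congr 1
        field_simp
        rw [Real.sq_sqrt hpos.le]

end EmpiricalRisk

section TwoPoint

theorem le_min_add_mul_add {a b c : ℝ} (ha : 0 ≤ a) (hb : 0 ≤ b) (hc : 0 ≤ c)
    (hab : c ≤ a * b) : c ≤ min a b + c / 4 * (a + b) := by
  wlog hle : a ≤ b generalizing a b
  · simpa only [min_comm b a, add_comm b a]
      using this hb ha (hab.trans_eq (mul_comm a b)) (le_of_not_ge hle)
  rw [min_eq_left hle]
  rcases le_total 4 (a + b) with hsum | hsum
  · nlinarith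
  · nlinarith [mul_nonneg ha (sq_nonneg (b - 2)), mul_nonneg ha (mul_nonneg ha hb),
      mul_le_mul_of_nonneg_right hab (sub_nonneg.2 hsum)]

theorem half_le_lintegral_min {Ω : Type*} [MeasurableSpace Ω] {μ : Measure Ω}
    [IsProbabilityMeasure μ] {D₁ D₂ : Ω → ℝ≥0} (hD₁ : Measurable D₁) (hD₂ : Measurable D₂)
    (h₁ : ∫⁻ ω, D₁ ω ∂μ = 1) (h₂ : ∫⁻ ω, D₂ ω ∂μ = 1) {c : ℝ≥0} (hc : ∀ ω, c ≤ D₁ ω * D₂ ω) :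
    (c / 2 : ℝ≥0) ≤ ∫⁻ ω, min (D₁ ω) (D₂ ω) ∂μ := by
  have hpoint : ∀ ω, (c : ℝ≥0∞)
      ≤ ((min (D₁ ω) (D₂ ω) : ℝ≥0) : ℝ≥0∞) + (c / 4 : ℝ≥0) * (D₁ ω + D₂ ω) := fun ω => by
    have h := le_min_add_mul_add (D₁ ω).coe_nonneg (D₂ ω).coe_nonneg c.coe_nonneg (hc ω)
    exact_mod_cast h
  have hint : (c : ℝ≥0∞) ≤ ∫⁻ ω, min (D₁ ω) (D₂ ω) ∂μ + (c / 2 : ℝ≥0) := by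
    have h := lintegral_mono (μ := μ) hpoint
    rw [lintegral_const, measure_univ, mul_one, lintegral_add_left (hD₁.min hD₂).coe_nnreal_ennreal,
      lintegral_const_mul' _ _ ENNReal.coe_ne_top,
      lintegral_add_left hD₁.coe_nnreal_ennreal, h₁, h₂] at h
    refine h.trans_eq (congrArg (_ + ·) ?_)
    norm_cast
    ring
  have hhalf : (c : ℝ≥0∞) = (c / 2 : ℝ≥0) + (c / 2 : ℝ≥0) := by
    rw [← ENNReal.coe_add, add_halves]
  rw [hhalf] at hint
  exact (ENNReal.add_le_add_iff_right ENNReal.coe_ne_top).1 hint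

theorem mul_lintegral_min_le_expectation_add {Ω : Type*} [MeasurableSpace Ω] {μ : Measure Ω}
    {D₁ D₂ : Ω → ℝ≥0∞} (hD₁ : Measurable D₁) (hD₂ : Measurable D₂) {f₁ f₂ : Ω → ℝ≥0∞} {b : ℝ≥0∞}
    (hb : ∀ ω, b ≤ f₁ ω + f₂ ω) :
    b * ∫⁻ ω, min (D₁ ω) (D₂ ω) ∂μ
      ≤ expectation (μ.withDensity D₁) f₁ + expectation (μ.withDensity D₂) f₂ := by
  simp only [expectation, ENNReal.iInf_add, ENNReal.add_iInf]
  refine le_iInf₂ fun g₂ hg₂ => le_iInf fun hfg₂ => le_iInf₂ fun g₁ hg₁ => le_iInf fun hfg₁ => ?_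
  rw [lintegral_withDensity_eq_lintegral_mul _ hD₁ hg₁,
    lintegral_withDensity_eq_lintegral_mul _ hD₂ hg₂, ← lintegral_add_left (hD₁.mul hg₁),
    ← lintegral_const_mul _ (hD₁.min hD₂)]
  refine lintegral_mono fun ω => ?_
  calc b * min (D₁ ω) (D₂ ω) ≤ (g₁ ω + g₂ ω) * min (D₁ ω) (D₂ ω) := by
        gcongr
        exact (hb ω).trans (add_le_add (hfg₁ ω) (hfg₂ ω))
    _ = min (D₁ ω) (D₂ ω) * g₁ ω + min (D₁ ω) (D₂ ω) * g₂ ω := by ring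
    _ ≤ D₁ ω * g₁ ω + D₂ ω * g₂ ω := by
        gcongr
        exacts [min_le_left _ _, min_le_right _ _]

theorem pi_withDensity {ι : Type*} [Fintype ι] {α : ι → Type*} [∀ i, MeasurableSpace (α i)]
    (μ : ∀ i, Measure (α i)) [∀ i, IsProbabilityMeasure (μ i)] {q : ∀ i, α i → ℝ≥0∞}
    (hq : ∀ i, Measurable (q i)) [∀ i, SigmaFinite ((μ i).withDensity (q i))] :
    (Measure.pi fun i => (μ i).withDensity (q i))
      = (Measure.pi μ).withDensity fun ω => ∏ i, q i (ω i) := by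
  refine Measure.pi_eq fun s hs => ?_
  have hind : (Set.univ.pi s).indicator (fun ω => ∏ i, q i (ω i))
      = fun ω => ∏ i, (s i).indicator (q i) (ω i) := by
    funext ω
    by_cases h : ω ∈ Set.univ.pi s
    · rw [Set.indicator_of_mem h]
      exact prod_congr rfl fun i _ => (Set.indicator_of_mem (h i trivial) _).symm
    · obtain ⟨i, hi⟩ := not_forall.1 (mt Set.mem_univ_pi.2 h)
      rw [Set.indicator_of_notMem h, prod_eq_zero (mem_univ i) (Set.indicator_of_notMem hi _)]
  have hm : ∀ i, Measurable ((s i).indicator (q i)) := fun i => (hq i).indicator (hs i)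
  rw [withDensity_apply _ (MeasurableSet.univ_pi hs),
    ← lintegral_indicator (MeasurableSet.univ_pi hs), hind,
    ProbabilityTheory.lintegral_prod_eq_prod_lintegral_of_indepFun univ
      (fun i (ω : ∀ i, α i) => (s i).indicator (q i) (ω i))
      (ProbabilityTheory.iIndepFun_pi fun i => (hm i).aemeasurable)
      fun i => (hm i).comp (measurable_pi_apply i)]
  refine prod_congr rfl fun i _ => ?_
  rw [(measurePreserving_eval μ i).lintegral_comp (hm i), withDensity_apply _ (hs i),
    lintegral_indicator (hs i)]

theorem lintegral_eq_one_of_withDensity {Ω : Type*} [MeasurableSpace Ω] {μ : Measure Ω}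
    {q : Ω → ℝ≥0∞} [IsProbabilityMeasure (μ.withDensity q)] : ∫⁻ ω, q ω ∂μ = 1 := by
  rw [← setLIntegral_univ, ← withDensity_apply _ MeasurableSet.univ, measure_univ]

theorem mul_pow_le_expectation_pi_add {α ι : Type*} [MeasurableSpace α] [Fintype ι] {μ : Measure α}
    [IsProbabilityMeasure μ] {q₁ q₂ : α → ℝ≥0} (hq₁ : Measurable q₁) (hq₂ : Measurable q₂)
    [IsProbabilityMeasure (μ.withDensity fun x => q₁ x)]
    [IsProbabilityMeasure (μ.withDensity fun x => q₂ x)] {c : ℝ≥0} (hc : ∀ x, c ≤ q₁ x * q₂ x)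
    {f₁ f₂ : (ι → α) → ℝ≥0∞} {b : ℝ≥0∞} (hb : ∀ ω, b ≤ f₁ ω + f₂ ω) :
    b * (c ^ Fintype.card ι / 2 : ℝ≥0)
      ≤ expectation (Measure.pi fun _ => μ.withDensity fun x => q₁ x) f₁
        + expectation (Measure.pi fun _ => μ.withDensity fun x => q₂ x) f₂ := by
  have hpi : ∀ q : α → ℝ≥0, Measurable q → [IsProbabilityMeasure (μ.withDensity fun x => q x)] →
      (Measure.pi fun _ : ι => μ.withDensity fun x => q x)
        = (Measure.pi fun _ => μ).withDensity fun ω => ((∏ i, q (ω i) : ℝ≥0) : ℝ≥0∞) := by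
    intro q hq _
    simp only [ENNReal.ofNNReal_finsetProd]
    exact pi_withDensity (fun _ => μ) fun _ => hq.coe_nnreal_ennreal
  have hmeas : ∀ q : α → ℝ≥0, Measurable q → Measurable fun ω : ι → α => ∏ i, q (ω i) :=
    fun q hq => measurable_fun_prod _ fun i _ => hq.comp (measurable_pi_apply i)
  have hint : ∀ q : α → ℝ≥0, Measurable q → [IsProbabilityMeasure (μ.withDensity fun x => q x)] →
      ∫⁻ ω, ((∏ i, q (ω i) : ℝ≥0) : ℝ≥0∞) ∂(Measure.pi fun _ : ι => μ) = 1 := fun q hq _ => by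
    have : IsProbabilityMeasure ((Measure.pi fun _ : ι => μ).withDensity
        fun ω => ((∏ i, q (ω i) : ℝ≥0) : ℝ≥0∞)) := by
      rw [← hpi q hq]
      infer_instance
    exact lintegral_eq_one_of_withDensity
  rw [hpi q₁ hq₁, hpi q₂ hq₂]
  refine le_trans ?_ (mul_lintegral_min_le_expectation_add (hmeas q₁ hq₁).coe_nnreal_ennreal
    (hmeas q₂ hq₂).coe_nnreal_ennreal hb)
  gcongr
  refine half_le_lintegral_min (hmeas q₁ hq₁) (hmeas q₂ hq₂) (hint q₁ hq₁) (hint q₂ hq₂) fun ω => ?_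
  rw [← prod_mul_distrib]
  exact (prod_const c).symm.trans_le (prod_le_prod' fun i _ => hc (ω i))

end TwoPoint

section Pairing

variable {X : Type*} [MeasurableSpace X]

theorem lintegral_prod_count_bool (μ : Measure X) {g : X × Bool → ℝ≥0∞} (hg : Measurable g) :
    ∫⁻ p, g p ∂(μ.prod Measure.count) = ∫⁻ x, (g (x, true) + g (x, false)) ∂μ := by
  simp only [lintegral_prod _ hg.aemeasurable, lintegral_count, tsum_bool, add_comm]

theorem measure_eq_add_slices (ν : Measure (X × Bool)) {E : Set (X × Bool)}
    (hE : MeasurableSet E) :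
    ν E = ν (((·, true) ⁻¹' E) ×ˢ {true}) + ν (((·, false) ⁻¹' E) ×ˢ {false}) := by
  rw [← measure_union
    (Set.disjoint_left.2 fun p hp hp' => Bool.noConfusion (hp.2.symm.trans hp'.2))
    ((measurable_prodMk_right hE).prod (measurableSet_singleton false))]
  congr 1
  ext ⟨x, b⟩
  cases b <;> simp

theorem measure_le_prod_count {μ : Measure X} [SFinite μ] {D : Set X} {E : Set (X × Bool)}
    (hD : ∀ x ∈ D, ∃ b, (x, b) ∈ E) : μ D ≤ (μ.prod Measure.count) E := by
  rw [← measure_toMeasurable E]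
  set T := toMeasurable (μ.prod Measure.count) E
  have hslice : ∀ b, (μ.prod Measure.count) (((·, b) ⁻¹' T) ×ˢ {b}) = μ ((·, b) ⁻¹' T) :=
    fun b => by rw [Measure.prod_prod, Measure.count_singleton, mul_one]
  calc μ D ≤ μ ((·, true) ⁻¹' T ∪ (·, false) ⁻¹' T) := measure_mono fun x hx => by
        obtain ⟨b, hb⟩ := hD x hx
        cases b
        exacts [Or.inr (subset_toMeasurable _ _ hb), Or.inl (subset_toMeasurable _ _ hb)]
    _ ≤ μ ((·, true) ⁻¹' T) + μ ((·, false) ⁻¹' T) := measure_union_le _ _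
    _ = (μ.prod Measure.count) T := by
        rw [measure_eq_add_slices _ (measurableSet_toMeasurable _ _), hslice, hslice]

theorem ext_of_fst_eq_of_prod_true {ν ν' : Measure (X × Bool)} [IsFiniteMeasure ν]
    (hfst : ν.fst = ν'.fst)
    (htrue : ∀ B, MeasurableSet B → ν (B ×ˢ {true}) = ν' (B ×ˢ {true})) : ν = ν' := by
  have hsplit : ∀ (ρ : Measure (X × Bool)) (B : Set X), MeasurableSet B →
      ρ.fst B = ρ (B ×ˢ {true}) + ρ (B ×ˢ {false}) := fun ρ B hB => by
    rw [Measure.fst_apply hB, measure_eq_add_slices ρ (measurable_fst hB)]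
    rfl
  have hfalse : ∀ B, MeasurableSet B → ν (B ×ˢ {false}) = ν' (B ×ˢ {false}) := fun B hB => by
    have h : ν.fst B = ν'.fst B := by rw [hfst]
    rw [hsplit ν B hB, hsplit ν' B hB, ← htrue B hB] at h
    exact (ENNReal.add_right_inj (measure_ne_top ν _)).1 h
  refine Measure.ext fun E hE => ?_
  rw [measure_eq_add_slices ν hE, measure_eq_add_slices ν' hE,
    htrue _ (measurable_prodMk_right hE), hfalse _ (measurable_prodMk_right hE)]

/-- The density, with respect to the product of the marginal and the counting measure on the labels,
of the distribution with labeling function `η`. -/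
noncomputable def labelDensity (η : X → ℝ) (p : X × Bool) : ℝ≥0∞ :=
  ENNReal.ofReal (if p.2 then η p.1 else 1 - η p.1)

omit [MeasurableSpace X] in
theorem labelDensity_add_labelDensity {η : X → ℝ} (h0 : ∀ x, 0 ≤ η x) (h1 : ∀ x, η x ≤ 1) (x : X) :
    labelDensity η (x, true) + labelDensity η (x, false) = 1 := by
  rw [labelDensity, labelDensity]
  simp [← ENNReal.ofReal_add (h0 x) (sub_nonneg.2 (h1 x))]

omit [MeasurableSpace X] in
theorem one_le_labelDensity_add {η η' : X → ℝ} {x : X} (hsum : η x + η' x = 1) (b : Bool) :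
    1 ≤ labelDensity η (x, b) + labelDensity η' (x, b) := by
  rw [labelDensity, labelDensity, ← ENNReal.ofReal_one]
  refine le_trans (ENNReal.ofReal_le_ofReal ?_) ENNReal.ofReal_add_le
  cases b <;> simp <;> linarith

theorem measurable_labelDensity {η : X → ℝ} (hη : Measurable η) : Measurable (labelDensity η) :=
  (Measurable.ite (measurable_snd (measurableSet_singleton true)) (hη.comp measurable_fst)
    (measurable_const.sub (hη.comp measurable_fst))).ennreal_ofReal

/-- The measure with marginal `μ` and labeling function `η`. -/
noncomputable def pairing (μ : Measure X) (η : X → ℝ) : Measure (X × Bool) :=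
  (μ.prod Measure.count).withDensity (labelDensity η)

theorem lintegral_pairing (μ : Measure X) {η : X → ℝ} (hη : Measurable η) {g : X × Bool → ℝ≥0∞}
    (hg : Measurable g) :
    ∫⁻ p, g p ∂(pairing μ η) = ∫⁻ x, (labelDensity η (x, true) * g (x, true)
      + labelDensity η (x, false) * g (x, false)) ∂μ := by
  rw [pairing, lintegral_withDensity_eq_lintegral_mul _ (measurable_labelDensity hη) hg]
  exact lintegral_prod_count_bool μ ((measurable_labelDensity hη).mul hg)

theorem fst_pairing (μ : Measure X) {η : X → ℝ} (hη : Measurable η) (h0 : ∀ x, 0 ≤ η x)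
    (h1 : ∀ x, η x ≤ 1) : (pairing μ η).fst = μ := by
  refine Measure.ext fun B hB => ?_
  rw [Measure.fst, ← lintegral_indicator_one hB, lintegral_map (measurable_one.indicator hB)
    measurable_fst, lintegral_pairing μ hη (g := fun p => B.indicator 1 p.1)
      ((measurable_one.indicator hB).comp measurable_fst), ← lintegral_indicator_one hB]
  simp only [← add_mul, labelDensity_add_labelDensity h0 h1, one_mul]

theorem isProbabilityMeasure_pairing (μ : Measure X) [IsProbabilityMeasure μ] {η : X → ℝ}
    (hη : Measurable η) (h0 : ∀ x, 0 ≤ η x) (h1 : ∀ x, η x ≤ 1) :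
    IsProbabilityMeasure (pairing μ η) :=
  ⟨by rw [← Measure.fst_univ, fst_pairing μ hη h0 h1, measure_univ]⟩

theorem IsPairing.eq_pairing {P : ProbabilityMeasure (X × Bool)} {μ : Measure X} {η : X → ℝ}
    (hP : IsPairing P μ η) (hη : Measurable η) (h0 : ∀ x, 0 ≤ η x) (h1 : ∀ x, η x ≤ 1) :
    (P : Measure (X × Bool)) = pairing μ η := by
  refine ext_of_fst_eq_of_prod_true (hP.1.trans (fst_pairing μ hη h0 h1).symm) fun B hB => ?_
  have hBtrue : MeasurableSet (B ×ˢ ({true} : Set Bool)) := hB.prod (measurableSet_singleton true)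
  rw [hP.2 B hB, ← lintegral_indicator_one hBtrue,
    lintegral_pairing μ hη (measurable_one.indicator hBtrue), ← lintegral_indicator hB]
  refine lintegral_congr fun x => ?_
  by_cases hx : x ∈ B <;> simp [labelDensity, hx]

theorem risk_eq_lintegral {μ : Measure X} {η : X → ℝ} (hη : Measurable η)
    {P : ProbabilityMeasure (X × Bool)} (hP : (P : Measure (X × Bool)) = pairing μ η) {f : X → Bool}
    (hf : Measurable f) : risk P f = ∫⁻ x, labelDensity η (x, !f x) ∂μ := by
  have hE : MeasurableSet {p : X × Bool | f p.1 ≠ p.2} :=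
    (measurableSet_eq_fun (hf.comp measurable_fst) measurable_snd).compl
  rw [risk, hP, ← lintegral_indicator_one hE, lintegral_pairing μ hη (measurable_one.indicator hE)]
  refine lintegral_congr fun x => ?_
  cases hx : f x <;> simp [hx]

theorem measure_le_risk_add_risk {μ : Measure X} [SFinite μ] {η η' : X → ℝ} (hη : Measurable η)
    {P Q : ProbabilityMeasure (X × Bool)} (hP : (P : Measure (X × Bool)) = pairing μ η)
    (hQ : (Q : Measure (X × Bool)) = pairing μ η') {D : Set X} (hD : MeasurableSet D)
    (hsum : ∀ x ∈ D, η x + η' x = 1) (f : X → Bool) : μ D ≤ risk P f + risk Q f := by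
  have hDprod : MeasurableSet (Prod.fst ⁻¹' D : Set (X × Bool)) := measurable_fst hD
  have hle : (μ.prod Measure.count).restrict (Prod.fst ⁻¹' D) ≤ pairing μ η + pairing μ η' := by
    rw [pairing, pairing, ← withDensity_add_left (measurable_labelDensity hη),
      ← withDensity_indicator_one hDprod]
    refine withDensity_mono (.of_forall fun p => Set.indicator_apply_le fun hp => ?_)
    exact one_le_labelDensity_add (hsum p.1 hp) p.2
  calc μ D ≤ (μ.prod Measure.count) ({p | f p.1 ≠ p.2} ∩ Prod.fst ⁻¹' D) :=
        measure_le_prod_count fun x hx => ⟨!f x, by simp, hx⟩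
    _ = (μ.prod Measure.count).restrict (Prod.fst ⁻¹' D) {p | f p.1 ≠ p.2} :=
        (Measure.restrict_apply' hDprod).symm
    _ ≤ (pairing μ η + pairing μ η') {p | f p.1 ≠ p.2} := hle _
    _ = risk P f + risk Q f := by rw [Measure.add_apply, risk, risk, hP, hQ]

end Pairing

section Rich

variable {X : Type*} {h h' : X → Bool}

theorem richLabeling_nonneg {α : ℝ} (hα : -(1 / 2) ≤ α) (x : X) : 0 ≤ richLabeling h h' α x := by
  unfold richLabeling
  split_ifs <;> linarith

theorem richLabeling_le_one {α : ℝ} (hα : α ≤ 1 / 2) (x : X) : richLabeling h h' α x ≤ 1 := by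
  unfold richLabeling
  split_ifs <;> linarith

theorem richLabeling_swap (h h' : X → Bool) (α : ℝ) :
    richLabeling h' h α = richLabeling h h' α := by
  funext x
  unfold richLabeling
  cases h x <;> cases h' x <;> simp

theorem setOf_ne_and_eq_swap (h h' : X → Bool) (b : Bool) :
    {x | h' x ≠ h x ∧ h' x = b} = {x | h x ≠ h' x ∧ h x = !b} := by
  ext x
  cases hx : h x <;> cases hx' : h' x <;> cases b <;> simp [hx, hx']

theorem labelDensity_richLabeling_of_eq (α : ℝ) {x : X} (hx : h x = h' x) (b : Bool) :
    labelDensity (richLabeling h h' α) (x, b) = if h x = b then 1 else 0 := by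
  cases b <;> cases hb : h' x <;> simp [labelDensity, richLabeling, hx, hb]

theorem labelDensity_richLabeling_of_ne (α : ℝ) {x : X} (hx : h x ≠ h' x) (b : Bool) :
    labelDensity (richLabeling h h' α) (x, b)
      = ENNReal.ofReal (1 / 2 + if b then α else -α) := by
  cases b
  · simp only [labelDensity, richLabeling, if_pos hx, Bool.false_eq_true, if_false]
    congr 1
    ring
  · simp only [labelDensity, richLabeling, if_pos hx, if_true]

/-- The density of the distribution with labeling function `richLabeling h h' α` relative to the one
with `α = 0`. -/
noncomputable def richDensity (h h' : X → Bool) (α : ℝ) (p : X × Bool) : ℝ≥0 :=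
  if h p.1 ≠ h' p.1 then Real.toNNReal (1 + 2 * if p.2 then α else -α) else 1

theorem labelDensity_richLabeling_eq_mul (h h' : X → Bool) (α : ℝ) (p : X × Bool) :
    labelDensity (richLabeling h h' α) p
      = labelDensity (richLabeling h h' 0) p * richDensity h h' α p := by
  obtain ⟨x, b⟩ := p
  by_cases hx : h x = h' x
  · simp only [labelDensity_richLabeling_of_eq _ hx, richDensity, ne_eq, hx, not_true_eq_false,
      if_false, ENNReal.coe_one, mul_one]
  · simp only [labelDensity_richLabeling_of_ne _ hx, richDensity, if_pos (show h x ≠ h' x from hx),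
      neg_zero, ite_self, add_zero]
    rw [← ENNReal.ofReal, ← ENNReal.ofReal_mul (by norm_num)]
    congr 1
    ring

theorem le_richDensity_mul {α : ℝ} (hlow : -(1 / 2) ≤ α) (hhigh : α ≤ 1 / 2) (p : X × Bool) :
    Real.toNNReal (1 - 4 * α ^ 2) ≤ richDensity h h' α p * richDensity h h' (-α) p := by
  have hprod : ∀ t : ℝ, 0 ≤ 1 + 2 * t → t ^ 2 = α ^ 2 →
      Real.toNNReal (1 - 4 * α ^ 2) = Real.toNNReal (1 + 2 * t) * Real.toNNReal (1 + 2 * -t) :=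
    fun t ht hα => by
      rw [← Real.toNNReal_mul ht, ← hα]
      congr 1
      ring
  unfold richDensity
  split_ifs
  · exact (hprod α (by linarith) rfl).le
  · exact (hprod (-α) (by linarith) (neg_sq α)).le
  · rw [mul_one, Real.toNNReal_le_one]
    linarith [sq_nonneg α]

variable [MeasurableSpace X]

theorem measurableSet_ne (hh : Measurable h) (hh' : Measurable h') :
    MeasurableSet {x | h x ≠ h' x} := (measurableSet_eq_fun hh hh').compl

theorem measurable_richLabeling (hh : Measurable h) (hh' : Measurable h') (α : ℝ) :
    Measurable (richLabeling h h' α) :=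
  Measurable.ite (measurableSet_ne hh hh') measurable_const
    (Measurable.ite (hh (measurableSet_singleton true)) measurable_const measurable_const)

theorem measurable_richDensity (hh : Measurable h) (hh' : Measurable h') (α : ℝ) :
    Measurable (richDensity h h' α) :=
  Measurable.ite (measurable_fst (measurableSet_ne hh hh'))
    ((Measurable.ite (measurable_snd (measurableSet_singleton true)) measurable_const
      measurable_const).const_mul 2 |>.const_add 1).real_toNNReal measurable_const

theorem pairing_richLabeling_eq_withDensity (μ : Measure X) (hh : Measurable h)
    (hh' : Measurable h') (α : ℝ) :
    pairing μ (richLabeling h h' α)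
      = (pairing μ (richLabeling h h' 0)).withDensity fun p => richDensity h h' α p := by
  rw [pairing, pairing, ← withDensity_mul _
    (measurable_labelDensity (measurable_richLabeling hh hh' 0))
    (measurable_richDensity hh hh' α).coe_nnreal_ennreal]
  exact congrArg _ (funext (labelDensity_richLabeling_eq_mul h h' α))

variable {μ : Measure X} {P Q : ProbabilityMeasure (X × Bool)} {α : ℝ}

theorem risk_add_risk_le {H : Set (X → Bool)} (hH : h ∈ H) (hH' : h' ∈ H) (f : X → Bool) :
    risk P f + risk Q f
      ≤ excessRisk P H f + excessRisk Q H f + (risk P h + risk Q h') := by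
  rw [add_add_add_comm]
  exact add_le_add (le_tsub_add.trans (add_le_add_right (iInf₂_le h hH) _))
    (le_tsub_add.trans (add_le_add_right (iInf₂_le h' hH') _))

theorem IsPairing.eq_pairing_richLabeling (hP : IsPairing P μ (richLabeling h h' α))
    (hh : Measurable h) (hh' : Measurable h') (hlow : -(1 / 2) ≤ α) (hhigh : α ≤ 1 / 2) :
    (P : Measure (X × Bool)) = pairing μ (richLabeling h h' α) :=
  hP.eq_pairing (measurable_richLabeling hh hh' α) (richLabeling_nonneg hlow)
    (richLabeling_le_one hhigh)

variable [IsFiniteMeasure μ]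

theorem risk_eq_of_richLabeling (hP : IsPairing P μ (richLabeling h h' α))
    (hh : Measurable h) (hh' : Measurable h') (hlow : -(1 / 2) ≤ α) (hhigh : α ≤ 1 / 2) :
    risk P h = ENNReal.ofReal ((1 / 2 - α) * μ.real {x | h x ≠ h' x ∧ h x = true}
      + (1 / 2 + α) * μ.real {x | h x ≠ h' x ∧ h x = false}) := by
  have hm : ∀ b, MeasurableSet {x | h x ≠ h' x ∧ h x = b} := fun b =>
    (measurableSet_ne hh hh').inter (hh (measurableSet_singleton b))
  have hpoint : ∀ x, labelDensity (richLabeling h h' α) (x, !h x)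
      = {x | h x ≠ h' x ∧ h x = true}.indicator (fun _ => ENNReal.ofReal (1 / 2 - α)) x
        + {x | h x ≠ h' x ∧ h x = false}.indicator (fun _ => ENNReal.ofReal (1 / 2 + α)) x := by
    intro x
    by_cases hx : h x = h' x
    · simp [labelDensity_richLabeling_of_eq _ hx, hx]
    · have hx' : h' x = !h x := Bool.eq_not.2 (Ne.symm hx)
      rw [labelDensity_richLabeling_of_ne _ hx]
      cases hb : h x <;> simp [hx', hb, sub_eq_add_neg]
  rw [risk_eq_lintegral (measurable_richLabeling hh hh' α)
      (hP.eq_pairing_richLabeling hh hh' hlow hhigh) hh, lintegral_congr hpoint,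
    lintegral_add_left (measurable_const.indicator (hm true)), lintegral_indicator_const (hm true),
    lintegral_indicator_const (hm false),
    ENNReal.ofReal_add (mul_nonneg (by linarith) measureReal_nonneg)
      (mul_nonneg (by linarith) measureReal_nonneg), ENNReal.ofReal_mul (by linarith),
    ENNReal.ofReal_mul (by linarith), ofReal_measureReal, ofReal_measureReal]

theorem le_excessRisk_add_excessRisk {H : Set (X → Bool)} (hH : h ∈ H) (hH' : h' ∈ H)
    (hh : Measurable h) (hh' : Measurable h') (hlow : -(1 / 2) ≤ α) (hhigh : α ≤ 1 / 2)
    (hP : IsPairing P μ (richLabeling h h' α)) (hQ : IsPairing Q μ (richLabeling h h' (-α)))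
    (f : X → Bool) :
    ENNReal.ofReal (2 * α * (μ.real {x | h x ≠ h' x ∧ h x = true}
      - μ.real {x | h x ≠ h' x ∧ h x = false})) ≤ excessRisk P H f + excessRisk Q H f := by
  set m₁ := μ.real {x | h x ≠ h' x ∧ h x = true} with hm₁
  set m₀ := μ.real {x | h x ≠ h' x ∧ h x = false} with hm₀
  have hriskP : risk P h = ENNReal.ofReal ((1 / 2 - α) * m₁ + (1 / 2 + α) * m₀) :=
    risk_eq_of_richLabeling hP hh hh' hlow hhigh
  have hriskQ : risk Q h' = ENNReal.ofReal ((1 / 2 - α) * m₁ + (1 / 2 + α) * m₀) := by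
    rw [← richLabeling_swap] at hQ
    rw [risk_eq_of_richLabeling hQ hh' hh (by linarith) (by linarith), setOf_ne_and_eq_swap h h',
      setOf_ne_and_eq_swap h h', add_comm, sub_neg_eq_add, ← sub_eq_add_neg, Bool.not_true,
      Bool.not_false]
  have hdisagree : ENNReal.ofReal (m₁ + m₀) ≤ risk P f + risk Q f := by
    have hsplit : m₁ + m₀ = μ.real {x | h x ≠ h' x} := by
      rw [← measureReal_inter_add_sdiff (hh (measurableSet_singleton true))]
      simp only [hm₁, hm₀, ← Bool.not_eq_true]
      rfl
    rw [hsplit, ofReal_measureReal]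
    exact measure_le_risk_add_risk (measurable_richLabeling hh hh' α)
      (hP.eq_pairing_richLabeling hh hh' hlow hhigh)
      (hQ.eq_pairing_richLabeling hh hh' (by linarith) (by linarith)) (measurableSet_ne hh hh')
      (fun x hx => by simp only [richLabeling, if_pos (show h x ≠ h' x from hx)]; ring) f
  have hnonneg : 0 ≤ (1 / 2 - α) * m₁ + (1 / 2 + α) * m₀ :=
    add_nonneg (mul_nonneg (by linarith) measureReal_nonneg)
      (mul_nonneg (by linarith) measureReal_nonneg)
  have hkey := hdisagree.trans (risk_add_risk_le hH hH' f)
  rw [hriskP, hriskQ, ← ENNReal.ofReal_add hnonneg hnonneg, ← tsub_le_iff_right,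
    ← ENNReal.ofReal_sub _ (add_nonneg hnonneg hnonneg)] at hkey
  refine (ENNReal.ofReal_le_ofReal (le_of_eq ?_)).trans hkey
  ring

end Rich

section MinimaxRates

variable {X : Type*} [MeasurableSpace X] {H : Set (X → Bool)}
  {𝓟 : Set (ProbabilityMeasure (X × Bool))}

theorem minimaxMarginal_le_minimaxSL (H : Set (X → Bool))
    (𝓟 : Set (ProbabilityMeasure (X × Bool))) (n : ℕ) :
    minimaxMarginal H 𝓟 n ≤ minimaxSL H 𝓟 n :=
  le_iInf fun A => iInf_le_of_le (fun n S _ => A n S) le_rfl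

theorem half_le_minimaxMarginal {P Q : ProbabilityMeasure (X × Bool)} (hP : P ∈ 𝓟) (hQ : Q ∈ 𝓟)
    (hPQ : marginal P = marginal Q) {n : ℕ} {K : ℝ≥0∞}
    (hK : ∀ F : (Fin n → X × Bool) → X → Bool,
      K ≤ expectation (sampleLaw P n) (fun S => excessRisk P H (F S))
        + expectation (sampleLaw Q n) fun S => excessRisk Q H (F S)) :
    K / 2 ≤ minimaxMarginal H 𝓟 n := by
  refine le_iInf fun A => ENNReal.div_le_of_le_mul ((hK fun S => A n S (marginal P)).trans ?_)
  rw [mul_two]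
  refine add_le_add (le_iSup₂_of_le P hP le_rfl) (le_iSup₂_of_le Q hQ ?_)
  rw [hPQ]

theorem le_minimaxMarginal_of_isPairing {h h' : X → Bool} (hH : h ∈ H) (hH' : h' ∈ H)
    (hh : Measurable h) (hh' : Measurable h') {μ : Measure X} [IsProbabilityMeasure μ]
    {P Q : ProbabilityMeasure (X × Bool)} (hP𝓟 : P ∈ 𝓟) (hQ𝓟 : Q ∈ 𝓟) {α : ℝ} (hα : 0 ≤ α)
    (hhigh : α ≤ 1 / 2) (hP : IsPairing P μ (richLabeling h h' α))
    (hQ : IsPairing Q μ (richLabeling h h' (-α))) (n : ℕ) :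
    ENNReal.ofReal (α * (1 - 4 * α ^ 2) ^ n / 2 * (μ.real {x | h x ≠ h' x ∧ h x = true}
      - μ.real {x | h x ≠ h' x ∧ h x = false})) ≤ minimaxMarginal H 𝓟 n := by
  set Δ := μ.real {x | h x ≠ h' x ∧ h x = true} - μ.real {x | h x ≠ h' x ∧ h x = false}
  set P₀ := pairing μ (richLabeling h h' 0)
  have : IsProbabilityMeasure P₀ := isProbabilityMeasure_pairing μ
    (measurable_richLabeling hh hh' 0) (richLabeling_nonneg (by norm_num))
    (richLabeling_le_one (by norm_num))
  have hPd : (P : Measure (X × Bool)) = P₀.withDensity fun p => richDensity h h' α p :=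
    (hP.eq_pairing_richLabeling hh hh' (by linarith) hhigh).trans
      (pairing_richLabeling_eq_withDensity μ hh hh' α)
  have hQd : (Q : Measure (X × Bool)) = P₀.withDensity fun p => richDensity h h' (-α) p :=
    (hQ.eq_pairing_richLabeling hh hh' (by linarith) (by linarith)).trans
      (pairing_richLabeling_eq_withDensity μ hh hh' (-α))
  have : IsProbabilityMeasure (P₀.withDensity fun p => richDensity h h' α p) := hPd ▸ inferInstance
  have : IsProbabilityMeasure (P₀.withDensity fun p => richDensity h h' (-α) p) :=
    hQd ▸ inferInstance
  refine le_trans (le_of_eq ?_) (half_le_minimaxMarginal hP𝓟 hQ𝓟 (hP.1.trans hQ.1.symm)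
    (K := ENNReal.ofReal (2 * α * Δ) * (Real.toNNReal (1 - 4 * α ^ 2) ^ n / 2 : ℝ≥0)) fun F => ?_)
  · have hpow : 0 ≤ 1 - 4 * α ^ 2 := by nlinarith
    rw [ENNReal.coe_div two_ne_zero, ENNReal.coe_pow, ENNReal.coe_ofNat, ← ENNReal.ofReal,
      ← ENNReal.ofReal_pow hpow, ← ENNReal.ofReal_ofNat, ← ENNReal.ofReal_div_of_pos two_pos,
      ← ENNReal.ofReal_mul' (by positivity), ← ENNReal.ofReal_div_of_pos two_pos]
    congr 1
    ring
  · rw [sampleLaw, sampleLaw, hPd, hQd]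
    simpa only [Fintype.card_fin] using mul_pow_le_expectation_pi_add
      (measurable_richDensity hh hh' α) (measurable_richDensity hh hh' (-α))
      (le_richDensity_mul (by linarith) hhigh) fun S =>
        le_excessRisk_add_excessRisk hH hH' hh hh' (by linarith) hhigh hP hQ (F S)

theorem exists_le_minimaxMarginal_of_lt {h h' : X → Bool} (hH : h ∈ H) (hH' : h' ∈ H)
    (hh : Measurable h) (hh' : Measurable h') {μ : Measure X} [IsProbabilityMeasure μ]
    (hlt : μ.real {x | h x ≠ h' x ∧ h x = false} < μ.real {x | h x ≠ h' x ∧ h x = true})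
    (hrich : ∀ α : ℝ, 0 < α → α < 1 / 2 →
      (∃ P ∈ 𝓟, IsPairing P μ (richLabeling h h' α)) ∧
      (∃ P ∈ 𝓟, IsPairing P μ (richLabeling h h' (-α)))) :
    ∃ c : ℝ, 0 < c ∧ ∀ n : ℕ, n ≠ 0 → ENNReal.ofReal (c * (1 / √n)) ≤ minimaxMarginal H 𝓟 n := by
  set Δ := μ.real {x | h x ≠ h' x ∧ h x = true} - μ.real {x | h x ≠ h' x ∧ h x = false}
  have hΔ : 0 < Δ := sub_pos.2 hlt
  refine ⟨3 / 32 * Δ, by positivity, fun n hn => ?_⟩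
  have hsqrt : 1 ≤ √(n : ℝ) := Real.one_le_sqrt.2 (by exact_mod_cast Nat.one_le_iff_ne_zero.2 hn)
  set α : ℝ := 1 / (4 * √n) with hα
  have hα0 : 0 < α := by positivity
  have hα4 : α ≤ 1 / 4 := one_div_le_one_div_of_le (by norm_num) (by linarith)
  obtain ⟨⟨P, hP𝓟, hP⟩, Q, hQ𝓟, hQ⟩ := hrich α hα0 (by linarith)
  have hbernoulli : 3 / 4 ≤ (1 - 4 * α ^ 2) ^ n := by
    have hnα : n * (4 * α ^ 2) = 1 / 4 := by
      rw [hα, div_pow, mul_pow, Real.sq_sqrt n.cast_nonneg]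
      field_simp
    calc (3 / 4 : ℝ) = 1 + n * -(4 * α ^ 2) := by linarith
      _ ≤ (1 + -(4 * α ^ 2)) ^ n := one_add_mul_le_pow (by nlinarith) n
      _ = (1 - 4 * α ^ 2) ^ n := by rw [← sub_eq_add_neg]
  refine le_trans (ENNReal.ofReal_le_ofReal ?_)
    (le_minimaxMarginal_of_isPairing hH hH' hh hh' hP𝓟 hQ𝓟 hα0.le (by linarith) hP hQ n)
  calc 3 / 32 * Δ * (1 / √n) = α * (3 / 4) / 2 * Δ := by
        rw [hα]
        field_simp
        norm_num
    _ ≤ α * (1 - 4 * α ^ 2) ^ n / 2 * Δ := by gcongr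

theorem exists_le_minimaxMarginal (hmeas : ∀ h ∈ H, Measurable h) (hrich : IsRich 𝓟 H) :
    ∃ c : ℝ, 0 < c ∧ ∀ n : ℕ, n ≠ 0 → ENNReal.ofReal (c * (1 / √n)) ≤ minimaxMarginal H 𝓟 n := by
  obtain ⟨h, hH, h', hH', μ, hne, hP⟩ := hrich
  have hne' : (μ : Measure X).real {x | h x ≠ h' x ∧ h x = false}
      ≠ (μ : Measure X).real {x | h x ≠ h' x ∧ h x = true} :=
    fun e => hne ((measureReal_eq_measureReal_iff).1 e)
  rcases hne'.lt_or_gt with hlt | hlt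
  · exact exists_le_minimaxMarginal_of_lt hH hH' (hmeas h hH) (hmeas h' hH') hlt hP
  · rw [← Bool.not_true, ← setOf_ne_and_eq_swap h h', ← Bool.not_false,
      ← setOf_ne_and_eq_swap h h'] at hlt
    simp only [← richLabeling_swap h h'] at hP
    exact exists_le_minimaxMarginal_of_lt hH' hH (hmeas h' hH') (hmeas h hH) hlt hP

theorem not_tendsto_div_zero_of_le_of_le {f f' : ℕ → ℝ≥0∞} {g : ℕ → ℝ} {c C : ℝ}
    (hc : 0 < c) (hC : 0 < C) (hg : ∀ n, n ≠ 0 → 0 < g n)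
    (hf : ∀ n, n ≠ 0 → ENNReal.ofReal (c * g n) ≤ f n)
    (hf' : ∀ n, n ≠ 0 → f' n ≤ ENNReal.ofReal (C * g n)) :
    ¬ Filter.Tendsto (fun n => f n / f' n) Filter.atTop (nhds 0) := by
  intro h
  have hpos : 0 < ENNReal.ofReal (c / C) := ENNReal.ofReal_pos.2 (by positivity)
  obtain ⟨n, hlt, hn⟩ :=
    ((h.eventually (gt_mem_nhds hpos)).and (Filter.eventually_ne_atTop 0)).exists
  have hgn := hg n hn
  refine hlt.not_ge ?_
  calc ENNReal.ofReal (c / C) = ENNReal.ofReal (c * g n) / ENNReal.ofReal (C * g n) := by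
        rw [← ENNReal.ofReal_div_of_pos (by positivity), mul_div_mul_right _ _ hgn.ne']
    _ ≤ f n / f' n := ENNReal.div_le_div (hf n hn) (hf' n hn)

end MinimaxRates

end SSL

theorem mainTheorem4 {X : Type*} [MeasurableSpace X]
    (H : Set (X → Bool)) (hmeas : ∀ h ∈ H, Measurable h) (hVC : SSL.FiniteVCDim H)
    (𝓟 : Set (ProbabilityMeasure (X × Bool)))
    (hclass : ∀ P ∈ 𝓟, SSL.IsMeasurableClass H (SSL.marginal P))
    (hrich : SSL.IsRich 𝓟 H) :
    ¬ SSL.MarginalHelps H 𝓟 ∧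
      SSL.HasRate (SSL.minimaxSL H 𝓟) (fun ℓ => 1 / Real.sqrt ℓ) ∧
      SSL.HasRate (SSL.minimaxMarginal H 𝓟) (fun ℓ => 1 / Real.sqrt ℓ) := by
  obtain ⟨d, hd⟩ := hVC
  obtain ⟨c, hc, hlower⟩ := SSL.exists_le_minimaxMarginal hmeas hrich
  obtain ⟨h, hH, -⟩ := hrich
  have hC : 0 < 2 * SSL.vcConstant d := mul_pos two_pos (SSL.vcConstant_pos d)
  have hle := SSL.minimaxMarginal_le_minimaxSL H 𝓟
  have hupper : ∀ n : ℕ, n ≠ 0 → SSL.minimaxSL H 𝓟 n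
      ≤ ENNReal.ofReal (2 * SSL.vcConstant d * (1 / Real.sqrt n)) :=
    fun n hn => SSL.minimaxSL_le ⟨h, hH⟩ hmeas hclass hd hn
  refine ⟨SSL.not_tendsto_div_zero_of_le_of_le hc hC (fun n hn => by positivity) hlower hupper,
    ⟨c, _, hc, hC, fun n hn => ?_⟩, ⟨c, _, hc, hC, fun n hn => ?_⟩⟩
  · exact ⟨(hlower n (by omega)).trans (hle n), hupper n (by omega)⟩
  · exact ⟨hlower n (by omega), (hle n).trans (hupper n (by omega))⟩
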